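/- Let $V$ be a finite set, let $s,t\in V$ with $s\neq t$, and let $E$ be the edge set of the complete graph on $V$. For $U\subseteq V$ let $\delta(U)\subseteq E$ be the set of edges with exactly one endpoint in $U$, write $\delta(v):=\delta(\{v\})$, and for $x\in\mathbb{R}^E$ and $F\subseteq E$ write $x(F):=\sum_{e\in F}x_e$ and let $\chi^F\in\{0,1\}^E$ be the characteristic vector of $F$. Let $\mathcal{S}$ be the set of edge sets of spanning trees of $(V,E)$. Let $x^*\in\mathbb{R}^E$ be a feasible solution of the $s$-$t$-path TSP linear program, that is, $$\begin{array}{ll} x^*(\delta(U))\ge 2 & (\emptyset\ne U\subsetneq V,\ |U\cap\{s,t\}|\text{ even}),\\ x^*(\delta(U))\ge 1 & (\emptyset\ne U\subsetneq V,\ |U\cap\{s,t\}|\text{ odd}),\\ x^*(\delta(v))=2 & (v\in V\setminus\{s,t\}),\\ x^*(\delta(v))=1 & (v\in\{s,t\}),\\ x^*_e\ge 0 & (e\in E). \end{array}$$ Call $C\subseteq E$ a narrow cut if $C=\delta(U)$ for some $\emptyset\ne U\subsetneq V$ and $x^*(C)<2$, and let $\mathcal{C}$ be the set of narrow cuts.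 Then there are $r\in\mathbb{N}$, $S_1,\dots,S_r\in\mathcal{S}$ and real numbers $p_1,\dots,p_r>0$ with $\sum_{j=1}^r p_j=1$ such that $x^*=\sum_{j=1}^r p_j\chi^{S_j}$ and for every $C\in\mathcal{C}$ there exists $k\in\{1,\dots,r\}$ with $\sum_{j=1}^k p_j\ge 2-x^*(C)$ and $|C\cap S_j|=1$ for all $j=1,\dots,k$. In particular, there is a global Gao tree in the support of $x^*$, i.e. an $S\in\mathcal{S}$ with $x^*_e>0$ for all $e\in S$ and $|C\cap S|=1$ for all $C\in\mathcal{C}$. -/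

import Mathlib

namespace PathTSP

/-- The edge set `E` of the complete graph on `V`. -/
abbrev Edge (V : Type*) : Type _ := {e : Sym2 V // ¬ e.IsDiag}

variable {V : Type*} [Fintype V] [DecidableEq V]

/-- `δ(U)`: the edges with exactly one endpoint in `U`. -/
def cut (U : Finset V) : Finset (Edge V) :=
  Finset.univ.filter fun e => ∃ u v : V, u ∈ U ∧ v ∉ U ∧ e.1 = s(u, v)

/-- `x(F) = ∑_{e ∈ F} x_e`. -/
def weight (x : Edge V → ℝ) (F : Finset (Edge V)) : ℝ :=
  ∑ e ∈ F, x e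

/-- The characteristic vector `χ^F ∈ {0,1}^E`. -/
def chi (F : Finset (Edge V)) : Edge V → ℝ :=
  fun e => if e ∈ F then 1 else 0

/-- Feasible solutions of the natural LP relaxation of the `s`-`t`-path TSP. -/
structure IsFeasible (s t : V) (x : Edge V → ℝ) : Prop where
  even_cut : ∀ U : Finset V, U.Nonempty → U ≠ Finset.univ →
    Even (U ∩ {s, t}).card → 2 ≤ weight x (cut U)
  odd_cut : ∀ U : Finset V, U.Nonempty → U ≠ Finset.univ →
    Odd (U ∩ {s, t}).card → 1 ≤ weight x (cut U)
  degree_inner : ∀ v : V, v ≠ s → v ≠ t → weight x (cut {v}) = 2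
  degree_left : weight x (cut {s}) = 1
  degree_right : weight x (cut {t}) = 1
  nonneg : ∀ e : Edge V, 0 ≤ x e

/-- `S` is the edge set of a spanning tree of the complete graph on `V`. -/
def IsSpanningTree (S : Finset (Edge V)) : Prop :=
  (SimpleGraph.fromEdgeSet {e : Sym2 V | ∃ f ∈ S, f.1 = e}).IsTree

/-- The narrow cuts of `x`: cuts `C = δ(U)`, `∅ ≠ U ⊂ V`, with `x(C) < 2`. -/
def narrowCuts (x : Edge V → ℝ) : Set (Finset (Edge V)) :=
  {C | (∃ U : Finset V, U.Nonempty ∧ U ≠ Finset.univ ∧ C = cut U) ∧ weight x C < 2}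

/-- `S` is a local Gao tree at the cut `C`. -/
def IsLocalGaoTree (C S : Finset (Edge V)) : Prop :=
  IsSpanningTree S ∧ (C ∩ S).card = 1

/-- `S` is a global Gao tree for `x`: a spanning tree that is a local Gao tree at every
narrow cut of `x`. -/
def IsGlobalGaoTree (x : Edge V → ℝ) (S : Finset (Edge V)) : Prop :=
  IsSpanningTree S ∧ ∀ C ∈ narrowCuts x, IsLocalGaoTree C S

end PathTSP

set_option linter.unusedSectionVars false

namespace PathTSP

variable {V : Type*} [Fintype V] [DecidableEq V]

/-! Spanning trees are peeled off x one at a time; what is left is a residual `z` in `σ` times the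
spanning tree polytope (`InCone`). By the degree equations the slack of x at A is x(δ(A))/2 + |A ∩
{s,t}|/2 - 1 (`IsFeasible.gap_eq`). Hence x lies in the polytope, and the narrow cuts, oriented to
contain s, form a chain (`IsNarrow.total`).

Suppose every tree removed so far crosses each cut with x(C) < 1 + σ exactly once. The removed part
is then tight on both sides of such a cut and, by uncrossing, on differences of two of them, so
there `z` has the slack of x. For the layers between consecutive cuts this yields three estimates:
z(C) < 2σ, one layer or two adjacent layers have slack below σ, and the edges that jump over a layer
have total weight below σ (`IsFeasible.exists_faceTree`).

The minimal face of `z` contains a tree (`InCone.exists_isFaceTree`). One of least total rise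
crosses each of these cuts once (`InCone.exists_faceTree_layered`): exchanges show that no edge
rises more than one layer and that within the minimal tight set of an edge no other tree edge
crosses the same cut. Two edges in one cut would therefore give two disjoint families of crossing
edges, each of weight at least σ, contradicting z(C) < 2σ.

Subtracting the tree until some strict inequality becomes an equality makes the process finite
(`IsResidual.step`). A narrow cut C is crossed once by every tree chosen while the removed mass 1 -
σ is below 2 - x(C), which is the claim. The first tree serves all narrow cuts. -/

/-- The edges with both endpoints in `A`. -/
def inside (A : Finset V) : Finset (Edge V) :=
  Finset.univ.filter fun e => ∀ v, v ∈ e.1 → v ∈ A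

/-- The edges with one endpoint in `X` and the other in `Y`. -/
def btw (X Y : Finset V) : Finset (Edge V) :=
  Finset.univ.filter fun e => ∃ u v : V, u ∈ X ∧ v ∈ Y ∧ e.1 = s(u, v)

/-! ### Edge sets and their weights. -/

theorem Edge.exists_eq (e : Edge V) : ∃ (u v : V) (h : ¬ s(u, v).IsDiag), e = ⟨s(u, v), h⟩ := by
  obtain ⟨e, he⟩ := e
  induction e using Sym2.ind with
  | _ u v => exact ⟨u, v, he, rfl⟩

theorem mem_inside {A : Finset V} {u v : V} {h : ¬ s(u, v).IsDiag} :
    (⟨s(u, v), h⟩ : Edge V) ∈ inside A ↔ u ∈ A ∧ v ∈ A := by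
  simp [inside]

theorem mem_btw {X Y : Finset V} {u v : V} {h : ¬ s(u, v).IsDiag} :
    (⟨s(u, v), h⟩ : Edge V) ∈ btw X Y ↔ (u ∈ X ∧ v ∈ Y) ∨ (v ∈ X ∧ u ∈ Y) := by
  simp only [btw, Finset.mem_filter, Finset.mem_univ, true_and, Sym2.eq_iff]
  constructor
  · rintro ⟨a, b, ha, hb, ⟨rfl, rfl⟩ | ⟨rfl, rfl⟩⟩
    · exact Or.inl ⟨ha, hb⟩
    · exact Or.inr ⟨ha, hb⟩
  · rintro (⟨ha, hb⟩ | ⟨ha, hb⟩)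
    · exact ⟨u, v, ha, hb, Or.inl ⟨rfl, rfl⟩⟩
    · exact ⟨v, u, ha, hb, Or.inr ⟨rfl, rfl⟩⟩

theorem mem_cut {U : Finset V} {u v : V} {h : ¬ s(u, v).IsDiag} :
    (⟨s(u, v), h⟩ : Edge V) ∈ cut U ↔ (u ∈ U ∧ v ∉ U) ∨ (v ∈ U ∧ u ∉ U) := by
  simp only [cut, Finset.mem_filter, Finset.mem_univ, true_and, Sym2.eq_iff]
  constructor
  · rintro ⟨a, b, ha, hb, ⟨rfl, rfl⟩ | ⟨rfl, rfl⟩⟩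
    · exact Or.inl ⟨ha, hb⟩
    · exact Or.inr ⟨ha, hb⟩
  · rintro (⟨ha, hb⟩ | ⟨ha, hb⟩)
    · exact ⟨u, v, ha, hb, Or.inl ⟨rfl, rfl⟩⟩
    · exact ⟨v, u, ha, hb, Or.inr ⟨rfl, rfl⟩⟩

theorem inside_mono {A B : Finset V} (h : A ⊆ B) : inside A ⊆ inside B := by
  intro e he
  obtain ⟨u, v, huv, rfl⟩ := e.exists_eq
  rw [mem_inside] at he ⊢
  exact ⟨h he.1, h he.2⟩

theorem inside_inter {A B : Finset V} : inside (A ∩ B) = inside A ∩ inside B := by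
  ext e
  obtain ⟨u, v, huv, rfl⟩ := e.exists_eq
  simp only [mem_inside, Finset.mem_inter]
  tauto

@[simp] theorem inside_univ : inside (Finset.univ : Finset V) = Finset.univ := by
  simp [inside]

theorem cut_compl (U : Finset V) : cut Uᶜ = cut U := by
  ext e
  obtain ⟨u, v, huv, rfl⟩ := e.exists_eq
  simp only [mem_cut, Finset.mem_compl]
  tauto

theorem weight_eq_sum (y : Edge V → ℝ) (F : Finset (Edge V)) :
    weight y F = ∑ e, if e ∈ F then y e else 0 := by
  simp [weight]

theorem weight_nonneg {y : Edge V → ℝ} (hy : ∀ e, 0 ≤ y e) (F : Finset (Edge V)) :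
    0 ≤ weight y F := Finset.sum_nonneg fun e _ => hy e

theorem weight_mono {y : Edge V → ℝ} (hy : ∀ e, 0 ≤ y e) {F G : Finset (Edge V)} (h : F ⊆ G) :
    weight y F ≤ weight y G :=
  Finset.sum_le_sum_of_subset_of_nonneg h fun e _ _ => hy e

theorem weight_add (y z : Edge V → ℝ) (F : Finset (Edge V)) :
    weight (y + z) F = weight y F + weight z F := by
  simp [weight, Finset.sum_add_distrib]

theorem weight_sub (y z : Edge V → ℝ) (F : Finset (Edge V)) :
    weight (y - z) F = weight y F - weight z F := by
  simp [weight, Finset.sum_sub_distrib]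

theorem weight_smul (c : ℝ) (y : Edge V → ℝ) (F : Finset (Edge V)) :
    weight (c • y) F = c * weight y F := by
  simp [weight, Finset.mul_sum]

theorem weight_chi (S F : Finset (Edge V)) : weight (chi S) F = ((S ∩ F).card : ℝ) := by
  simp [weight, chi, Finset.sum_ite_mem, Finset.inter_comm]

theorem exists_pos_of_weight_pos {y : Edge V → ℝ} {F : Finset (Edge V)} (h : 0 < weight y F) :
    ∃ e ∈ F, 0 < y e := by
  by_contra! hc
  exact absurd h (not_lt.2 (Finset.sum_nonpos hc))

/-! ### The scaled spanning tree polytope and uncrossing. -/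

/-- The slack of the rank constraint at `A` of the spanning tree polytope scaled by `σ`. -/
def gap (y : Edge V → ℝ) (σ : ℝ) (A : Finset V) : ℝ :=
  σ * ((A.card : ℝ) - 1) - weight y (inside A)

/-- `σ` times the spanning tree polytope, described by inequalities. -/
structure InCone (y : Edge V → ℝ) (σ : ℝ) : Prop where
  nonneg : ∀ e, 0 ≤ y e
  gap_nonneg : ∀ A : Finset V, A.Nonempty → 0 ≤ gap y σ A
  gap_univ : gap y σ Finset.univ = 0

theorem weight_uncross (y : Edge V → ℝ) (A B : Finset V) :
    weight y (inside A) + weight y (inside B) + weight y (btw (A \ B) (B \ A)) =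
      weight y (inside (A ∩ B)) + weight y (inside (A ∪ B)) := by
  simp only [weight_eq_sum, ← Finset.sum_add_distrib]
  refine Finset.sum_congr rfl fun e _ => ?_
  obtain ⟨u, v, huv, rfl⟩ := e.exists_eq
  simp only [mem_inside, mem_btw, Finset.mem_inter, Finset.mem_union, Finset.mem_sdiff]
  by_cases h1 : u ∈ A <;> by_cases h2 : u ∈ B <;> by_cases h3 : v ∈ A <;> by_cases h4 : v ∈ B <;>
    simp [h1, h2, h3, h4]

/-- Cardinality is modular and the induced weight is supermodular, with defect exactly the edges
between the two differences. Keeping this defect is what later forces those edges to vanish for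
tight sets. -/
theorem gap_uncross (y : Edge V → ℝ) (σ : ℝ) (A B : Finset V) :
    gap y σ A + gap y σ B =
      gap y σ (A ∩ B) + gap y σ (A ∪ B) + weight y (btw (A \ B) (B \ A)) := by
  have h1 := weight_uncross y A B
  have h2 : ((A ∪ B).card : ℝ) + (A ∩ B).card = A.card + B.card := by
    exact_mod_cast Finset.card_union_add_card_inter A B
  unfold gap
  linear_combination σ * (-h2) - h1

/-- This is uncrossing for two disjoint pieces; the extra σ comes from the empty intersection, whose
slack is -σ. -/
theorem gap_split (y : Edge V → ℝ) (σ : ℝ) (A X : Finset V) :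
    gap y σ (A ∩ X) + gap y σ (A \ X) + σ = gap y σ A + weight y (inside A ∩ cut X) := by
  have h := gap_uncross y σ (A ∩ X) (A \ X)
  have h1 : (A ∩ X) ∩ (A \ X) = ∅ := by ext; simp
  have h2 : (A ∩ X) ∪ (A \ X) = A := by ext; simp; tauto
  have h3 : btw ((A ∩ X) \ (A \ X)) ((A \ X) \ (A ∩ X)) = inside A ∩ cut X := by
    ext e
    obtain ⟨u, v, huv, rfl⟩ := e.exists_eq
    simp only [mem_inside, mem_btw, mem_cut, Finset.mem_inter, Finset.mem_sdiff]
    tauto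
  have h4 : gap y σ ∅ = -σ := by
    have : inside (∅ : Finset V) = ∅ := by
      ext e
      obtain ⟨u, v, huv, rfl⟩ := e.exists_eq
      simp [mem_inside]
    simp [gap, this, weight]
  rw [h1, h2, h3, h4] at h
  linarith

theorem gap_add (y z : Edge V → ℝ) (σ τ : ℝ) (A : Finset V) :
    gap (y + z) (σ + τ) A = gap y σ A + gap z τ A := by
  simp only [gap, weight_add]; ring

theorem gap_smul (c : ℝ) (y : Edge V → ℝ) (σ : ℝ) (A : Finset V) :
    gap (c • y) (c * σ) A = c * gap y σ A := by
  simp only [gap, weight_smul]; ring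

theorem InCone.add {y z : Edge V → ℝ} {σ τ : ℝ} (hy : InCone y σ) (hz : InCone z τ) :
    InCone (y + z) (σ + τ) where
  nonneg e := add_nonneg (hy.nonneg e) (hz.nonneg e)
  gap_nonneg A hA := by
    rw [gap_add]; exact add_nonneg (hy.gap_nonneg A hA) (hz.gap_nonneg A hA)
  gap_univ := by rw [gap_add, hy.gap_univ, hz.gap_univ, add_zero]

theorem InCone.smul {y : Edge V → ℝ} {σ c : ℝ} (hc : 0 ≤ c) (hy : InCone y σ) :
    InCone (c • y) (c * σ) where
  nonneg e := mul_nonneg hc (hy.nonneg e)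
  gap_nonneg A hA := by
    rw [gap_smul]; exact mul_nonneg hc (hy.gap_nonneg A hA)
  gap_univ := by rw [gap_smul, hy.gap_univ, mul_zero]

/-- `A` is tight for `y`: the rank constraint at `A` holds with equality. -/
def IsTight (y : Edge V → ℝ) (σ : ℝ) (A : Finset V) : Prop :=
  A.Nonempty ∧ gap y σ A = 0

theorem InCone.tight_inter_union {y : Edge V → ℝ} {σ : ℝ} (hy : InCone y σ) {A B : Finset V}
    (hA : IsTight y σ A) (hB : IsTight y σ B) (hAB : (A ∩ B).Nonempty) :
    IsTight y σ (A ∩ B) ∧ IsTight y σ (A ∪ B) ∧ weight y (btw (A \ B) (B \ A)) = 0 := by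
  have h := gap_uncross y σ A B
  have h1 := hy.gap_nonneg _ hAB
  have hne : (A ∪ B).Nonempty := hA.1.mono Finset.subset_union_left
  have h2 := hy.gap_nonneg _ hne
  have h3 := weight_nonneg hy.nonneg (btw (A \ B) (B \ A))
  rw [hA.2, hB.2] at h
  exact ⟨⟨hAB, by linarith⟩, ⟨hne, by linarith⟩, by linarith⟩

/-- Slack bounds for layers thereby pass to the part of a layer inside a tight set, which is where
exchanges take place. -/
theorem InCone.gap_inter_le {y : Edge V → ℝ} {σ : ℝ} (hy : InCone y σ) {A B : Finset V}
    (hA : IsTight y σ A) : gap y σ (A ∩ B) ≤ gap y σ B := by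
  have h := gap_uncross y σ A B
  have h2 := hy.gap_nonneg (A ∪ B) (hA.1.mono Finset.subset_union_left)
  have h3 := weight_nonneg hy.nonneg (btw (A \ B) (B \ A))
  rw [hA.2] at h
  linarith

/-- A set of slack less than `σ` is connected in the support. -/
theorem InCone.exists_crossing {y : Edge V → ℝ} {σ : ℝ} (hy : InCone y σ) {A X : Finset V}
    (hA : gap y σ A < σ) (h1 : (A ∩ X).Nonempty) (h2 : (A \ X).Nonempty) :
    ∃ e ∈ inside A ∩ cut X, 0 < y e := by
  apply exists_pos_of_weight_pos
  have h := gap_split y σ A X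
  have := hy.gap_nonneg _ h1
  have := hy.gap_nonneg _ h2
  linarith

theorem InCone.le_weight_crossing {y : Edge V → ℝ} {σ : ℝ} (hy : InCone y σ) {A X : Finset V}
    (hA : IsTight y σ A) (h1 : (A ∩ X).Nonempty) (h2 : (A \ X).Nonempty) :
    σ ≤ weight y (inside A ∩ cut X) := by
  have h := gap_split y σ A X
  have := hy.gap_nonneg _ h1
  have := hy.gap_nonneg _ h2
  rw [hA.2] at h
  linarith

/-! ### Spanning trees through cuts and edge counts. -/

/-- `S` connects `A`: the edges of `S` inside `A` cross every bipartition of `A`. -/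
def Conn (S : Finset (Edge V)) (A : Finset V) : Prop :=
  ∀ X : Finset V, (A ∩ X).Nonempty → (A \ X).Nonempty → ∃ e ∈ S, e ∈ inside A ∧ e ∈ cut X

/-- Spanning trees, described by cuts and by the number of edges. -/
structure IsTreeSet (S : Finset (Edge V)) : Prop where
  conn : Conn S Finset.univ
  card : S.card + 1 = Fintype.card V

theorem Conn.mono {S T : Finset (Edge V)} {A : Finset V} (h : Conn S A)
    (hST : ∀ e ∈ S, e ∈ inside A → e ∈ T) : Conn T A := by
  intro X h1 h2
  obtain ⟨e, he, hA, hX⟩ := h X h1 h2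
  exact ⟨e, hST e he hA, hA, hX⟩

/-- Grow A to B one vertex at a time along crossing edges; each new vertex brings a new edge. A
singleton A gives the lower bound on the edges of a connected set, and B = V gives the forest upper
bound. -/
theorem Conn.card_sdiff {S : Finset (Edge V)} {B : Finset V} (hS : Conn S B) :
    ∀ (k : ℕ) (A : Finset V), A ⊆ B → A.Nonempty → (B \ A).card = k →
      k ≤ ((S ∩ inside B) \ inside A).card := by
  intro k
  induction k with
  | zero => intros; exact Nat.zero_le _
  | succ k ih =>
    intro A hAB hA hk
    have hne : (B \ A).Nonempty := by rw [← Finset.card_pos]; omega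
    obtain ⟨e, heS, heB, heA⟩ := hS A (by rwa [Finset.inter_eq_right.2 hAB]) hne
    obtain ⟨v, hv, hvA, heI⟩ : ∃ v ∈ B, v ∉ A ∧ e ∈ inside (insert v A) ∧ e ∉ inside A := by
      obtain ⟨u, v, huv, rfl⟩ := e.exists_eq
      rw [mem_inside] at heB
      rw [mem_cut] at heA
      simp only [mem_inside]
      rcases heA with ⟨h1, h2⟩ | ⟨h1, h2⟩
      · exact ⟨v, heB.2, h2, by simp [h1], by simp [h2]⟩
      · exact ⟨u, heB.1, h2, by simp [h1], by simp [h2]⟩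
    have hvA' : (B \ insert v A).card = k := by
      have h1 : B \ A = insert v (B \ insert v A) := by
        ext w; simp only [Finset.mem_sdiff, Finset.mem_insert]
        by_cases hw : w = v
        · subst hw; simp [hv, hvA]
        · simp [hw]
      rw [h1, Finset.card_insert_of_notMem (by simp)] at hk
      omega
    have h2 := ih (insert v A) (Finset.insert_subset hv hAB) (by simp) hvA'
    have h3 : insert e ((S ∩ inside B) \ inside (insert v A)) ⊆ (S ∩ inside B) \ inside A := by
      intro f hf
      rw [Finset.mem_insert] at hf
      rcases hf with rfl | hf
      · simp [heS, heB, heI.2]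
      · simp only [Finset.mem_sdiff, Finset.mem_inter] at hf ⊢
        exact ⟨hf.1, fun h => hf.2 (inside_mono (Finset.subset_insert v A) h)⟩
    have h4 := Finset.card_le_card h3
    rw [Finset.card_insert_of_notMem (by simp [heI.1])] at h4
    omega

theorem Conn.card_le {S : Finset (Edge V)} {A : Finset V} (hS : Conn S A) (hA : A.Nonempty) :
    A.card ≤ (S ∩ inside A).card + 1 := by
  obtain ⟨v, hv⟩ := hA
  have h := hS.card_sdiff _ {v} (by simpa using hv) (by simp) rfl
  rw [Finset.card_sdiff_of_subset (by simpa using hv), Finset.card_singleton] at h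
  have := Finset.card_le_card (Finset.sdiff_subset (s := S ∩ inside A) (t := inside {v}))
  omega

theorem IsTreeSet.card_inside_le {S : Finset (Edge V)} (hS : IsTreeSet S) {A : Finset V}
    (hA : A.Nonempty) : (S ∩ inside A).card + 1 ≤ A.card := by
  have h := hS.conn.card_sdiff _ A (Finset.subset_univ A) hA rfl
  rw [inside_univ, Finset.inter_univ, Finset.card_sdiff_of_subset (Finset.subset_univ A)] at h
  have h1 := Finset.card_sdiff_add_card_inter S (inside A)
  have h2 := hS.card
  have h3 := Finset.card_le_univ A
  rw [Finset.card_univ] at h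
  omega

theorem IsTreeSet.conn_iff {S : Finset (Edge V)} (hS : IsTreeSet S) {A : Finset V}
    (hA : A.Nonempty) : Conn S A ↔ (S ∩ inside A).card + 1 = A.card := by
  constructor
  · intro h
    have := h.card_le hA
    have := hS.card_inside_le hA
    omega
  · intro h X h1 h2
    by_contra! hc
    have h3 := hS.card_inside_le h1
    have h4 := hS.card_inside_le h2
    have h5 : S ∩ inside A ⊆ (S ∩ inside (A ∩ X)) ∪ (S ∩ inside (A \ X)) := by
      intro e he
      rw [Finset.mem_inter] at he
      have := hc e he.1 he.2
      obtain ⟨u, v, huv, rfl⟩ := e.exists_eq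
      simp only [Finset.mem_union, Finset.mem_inter, mem_inside, mem_cut, Finset.mem_sdiff] at *
      tauto
    have h6 := (Finset.card_le_card h5).trans (Finset.card_union_le _ _)
    have h7 := Finset.card_inter_add_card_sdiff A X
    omega

theorem gap_chi (S : Finset (Edge V)) (A : Finset V) :
    gap (chi S) 1 A = (A.card : ℝ) - 1 - ((S ∩ inside A).card : ℝ) := by
  simp [gap, weight_chi]

theorem IsTreeSet.inCone {S : Finset (Edge V)} (hS : IsTreeSet S) : InCone (chi S) 1 where
  nonneg e := by unfold chi; split_ifs <;> norm_num
  gap_nonneg A hA := by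
    have : ((S ∩ inside A).card : ℝ) + 1 ≤ A.card := by exact_mod_cast hS.card_inside_le hA
    rw [gap_chi]; linarith
  gap_univ := by
    have : (S.card : ℝ) + 1 = Fintype.card V := by exact_mod_cast hS.card
    rw [gap_chi, inside_univ, Finset.inter_univ, Finset.card_univ]; linarith

theorem IsTreeSet.gap_chi_eq_zero {S : Finset (Edge V)} (hS : IsTreeSet S) {A : Finset V}
    (hA : A.Nonempty) (h : Conn S A) : gap (chi S) 1 A = 0 := by
  have : ((S ∩ inside A).card : ℝ) + 1 = A.card := by exact_mod_cast (hS.conn_iff hA).1 h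
  rw [gap_chi]; linarith

/-- Removing an edge from a spanning tree leaves two sides joined only by that edge. -/
theorem IsTreeSet.exists_side {S : Finset (Edge V)} (hS : IsTreeSet S) {e : Edge V} (he : e ∈ S) :
    ∃ X : Finset V, S ∩ cut X = {e} := by
  have hne : (Finset.univ : Finset V).Nonempty := by
    rw [← Finset.card_pos, Finset.card_univ, ← hS.card]; omega
  have h : ¬ Conn (S.erase e) Finset.univ := by
    intro h
    have h1 := h.card_le hne
    rw [inside_univ, Finset.inter_univ, Finset.card_erase_of_mem he, Finset.card_univ] at h1
    have := hS.card
    have := Finset.card_pos.2 ⟨e, he⟩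
    omega
  unfold Conn at h
  push Not at h
  obtain ⟨X, h1, h2, h3⟩ := h
  refine ⟨X, ?_⟩
  obtain ⟨f, hf, hf', hfX⟩ := hS.conn X h1 h2
  have key : ∀ g ∈ S, g ∈ cut X → g = e := by
    intro g hg hgX
    by_contra hge
    exact h3 g (Finset.mem_erase.2 ⟨hge, hg⟩) (by simp) hgX
  ext g
  simp only [Finset.mem_inter, Finset.mem_singleton]
  constructor
  · exact fun h => key g h.1 h.2
  · rintro rfl
    exact ⟨he, key f hf hfX ▸ hfX⟩

theorem cut_symmDiff (X Y : Finset V) : cut (symmDiff X Y) = symmDiff (cut X) (cut Y) := by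
  ext e
  obtain ⟨u, v, huv, rfl⟩ := e.exists_eq
  simp only [Finset.mem_symmDiff, mem_cut]
  tauto

theorem IsTreeSet.exists_mem_cut {S : Finset (Edge V)} (hS : IsTreeSet S) {X : Finset V} {v w : V}
    (hv : v ∈ X) (hw : w ∉ X) : ∃ e ∈ S, e ∈ cut X := by
  obtain ⟨e, he, -, heX⟩ := hS.conn X ⟨v, by simpa using hv⟩ ⟨w, by simpa using hw⟩
  exact ⟨e, he, heX⟩

/-- Some edge of the tree path from `v` to `w` leaves a given set containing `v` but not `w`. -/
theorem IsTreeSet.exists_path_edge {S : Finset (Edge V)} (hS : IsTreeSet S) {v w : V} :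
    ∀ (k : ℕ) (R : Finset V), (S ∩ cut R).card = k → v ∈ R → w ∉ R →
      ∃ e ∈ S, e ∈ cut R ∧ ∃ X : Finset V, S ∩ cut X = {e} ∧ v ∈ X ∧ w ∉ X := by
  intro k
  induction k using Nat.strong_induction_on with
  | _ k ih =>
    intro R hk hv hw
    obtain ⟨e, he, heR⟩ := hS.exists_mem_cut hv hw
    obtain ⟨X, hX⟩ := hS.exists_side he
    by_cases h1 : v ∈ X ↔ w ∈ X
    -- The side of `e` avoiding both v and w: adding it to R modulo 2 removes exactly `e` from the
    -- tree edges leaving R and keeps v and w apart.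
    · obtain ⟨Y, hY, hvY, hwY⟩ : ∃ Y : Finset V, S ∩ cut Y = {e} ∧ v ∉ Y ∧ w ∉ Y := by
        by_cases h2 : v ∈ X
        · exact ⟨Xᶜ, by rwa [cut_compl], by simpa using h2, by simpa using h1.1 h2⟩
        · exact ⟨X, hX, h2, fun h => h2 (h1.2 h)⟩
      have h3 : S ∩ cut (symmDiff R Y) = (S ∩ cut R).erase e := by
        ext f
        have := Finset.ext_iff.1 hY f
        simp only [cut_symmDiff, Finset.mem_inter, Finset.mem_erase, Finset.mem_symmDiff,
          Finset.mem_singleton] at this ⊢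
        by_cases hf : f = e
        · subst hf; tauto
        · tauto
      have h4 : e ∈ S ∩ cut R := Finset.mem_inter.2 ⟨he, heR⟩
      have h5 : (S ∩ cut (symmDiff R Y)).card < k := by
        rw [h3, ← hk]; exact Finset.card_erase_lt_of_mem h4
      obtain ⟨f, hf, hfR, hfX⟩ := ih _ h5 (symmDiff R Y) rfl
        (by simp [Finset.mem_symmDiff, hv, hvY]) (by simp [Finset.mem_symmDiff, hw, hwY])
      have h6 : f ∈ S ∩ cut (symmDiff R Y) := Finset.mem_inter.2 ⟨hf, hfR⟩
      rw [h3] at h6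
      exact ⟨f, hf, (Finset.mem_inter.1 (Finset.mem_of_mem_erase h6)).2, hfX⟩
    · by_cases h2 : v ∈ X
      · exact ⟨e, he, heR, X, hX, h2, by tauto⟩
      · exact ⟨e, he, heR, Xᶜ, by rwa [cut_compl], by simpa using h2, by simp; tauto⟩

/-- Exchanging `e` for another edge across the side of `e` gives a spanning tree again. -/
theorem IsTreeSet.exchange {S : Finset (Edge V)} (hS : IsTreeSet S) {e f : Edge V} {X : Finset V}
    (hX : S ∩ cut X = {e}) (hf : f ∈ cut X) (hfe : f ≠ e) :
    IsTreeSet (insert f (S.erase e)) := by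
  have heS : e ∈ S := (Finset.mem_inter.1 (hX ▸ Finset.mem_singleton_self e)).1
  have hfS : f ∉ S := fun h => hfe (by
    have : f ∈ S ∩ cut X := Finset.mem_inter.2 ⟨h, hf⟩
    rwa [hX, Finset.mem_singleton] at this)
  constructor
  · intro Z h1 h2
    by_cases h : ∃ g ∈ S.erase e, g ∈ cut Z
    · obtain ⟨g, hg, hgZ⟩ := h
      exact ⟨g, Finset.mem_insert_of_mem hg, by simp, hgZ⟩
    · push Not at h
      refine ⟨f, Finset.mem_insert_self _ _, by simp, ?_⟩
      obtain ⟨g, hg, -, hgZ⟩ := hS.conn Z h1 h2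
      have hge : g = e := by
        by_contra hge
        exact h g (Finset.mem_erase.2 ⟨hge, hg⟩) hgZ
      subst hge
      -- The removed edge is the only tree edge crossing X and also the only one crossing Z, so no
      -- tree edge crosses the symmetric difference. That set is thus empty or everything, and X and
      -- Z define the same cut.
      have h3 : ∀ g' ∈ S, g' ∉ cut (symmDiff X Z) := by
        intro g' hg'
        have h4 := Finset.ext_iff.1 hX g'
        simp only [cut_symmDiff, Finset.mem_symmDiff, Finset.mem_inter,
          Finset.mem_singleton] at h4 ⊢
        by_cases hgg : g' = g
        · subst hgg; tauto
        · have := h g' (Finset.mem_erase.2 ⟨hgg, hg'⟩)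
          tauto
      have h5 : (∀ v, v ∈ symmDiff X Z) ∨ (∀ v, v ∉ symmDiff X Z) := by
        by_contra! hc
        obtain ⟨⟨w, hw⟩, ⟨v, hv⟩⟩ := hc
        obtain ⟨g', hg', h6⟩ := hS.exists_mem_cut hv hw
        exact h3 g' hg' h6
      obtain ⟨u, v, huv, rfl⟩ := f.exists_eq
      rw [mem_cut] at hf ⊢
      simp only [Finset.mem_symmDiff] at h5
      rcases h5 with h5 | h5 <;> have hu := h5 u <;> have hv := h5 v <;> tauto
  · rw [Finset.card_insert_of_notMem (fun h => hfS (Finset.mem_of_mem_erase h)),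
      Finset.card_erase_of_mem heS, ← hS.card]
    have := Finset.card_pos.2 ⟨e, heS⟩
    omega

theorem Conn.insert_vertex {S : Finset (Edge V)} {A : Finset V} (hS : Conn S A) {e : Edge V}
    {v : V} (heA : e ∈ cut A) (heI : e ∈ inside (insert v A)) :
    Conn (insert e S) (insert v A) := by
  intro X h1 h2
  by_cases h : (A ∩ X).Nonempty ∧ (A \ X).Nonempty
  · obtain ⟨f, hf, hfA, hfX⟩ := hS X h.1 h.2
    exact ⟨f, Finset.mem_insert_of_mem hf, inside_mono (Finset.subset_insert v A) hfA, hfX⟩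
  · refine ⟨e, Finset.mem_insert_self _ _, heI, ?_⟩
    have h3 : (∀ w ∈ A, w ∉ X) ∨ (∀ w ∈ A, w ∈ X) := by
      by_contra! hc
      obtain ⟨⟨w, hw, hwX⟩, ⟨u, hu, huX⟩⟩ := hc
      exact h ⟨⟨w, by simp [hw, hwX]⟩, ⟨u, by simp [hu, huX]⟩⟩
    obtain ⟨a, b, hab, rfl⟩ := e.exists_eq
    obtain ⟨p, hp⟩ := h1
    obtain ⟨q, hq⟩ := h2
    simp only [mem_cut, mem_inside, Finset.mem_insert, Finset.mem_inter,
      Finset.mem_sdiff] at *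
    rcases h3 with h3 | h3
    · have : p = v := by
        rcases hp.1 with h | h
        · exact h
        · exact absurd hp.2 (h3 p h)
      subst this
      rcases heA with ⟨ha, hb⟩ | ⟨ha, hb⟩
      · have hb' : b = p := by tauto
        subst hb'
        exact Or.inr ⟨hp.2, h3 a ha⟩
      · have hb' : a = p := by tauto
        subst hb'
        exact Or.inl ⟨hp.2, h3 b ha⟩
    · have : q = v := by
        rcases hq.1 with h | h
        · exact h
        · exact absurd (h3 q h) hq.2
      subst this
      rcases heA with ⟨ha, hb⟩ | ⟨ha, hb⟩
      · have hb' : b = q := by tauto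
        subst hb'
        exact Or.inl ⟨h3 a ha, hq.2⟩
      · have hb' : a = q := by tauto
        subst hb'
        exact Or.inr ⟨h3 b ha, hq.2⟩

/-- Prim's algorithm: extend a tree on A by an edge of F leaving A. -/
theorem Conn.exists_isTreeSet [Nonempty V] {F : Finset (Edge V)} (hF : Conn F Finset.univ) :
    ∃ S ⊆ F, IsTreeSet S := by
  have key : ∀ k < Fintype.card V, ∃ (A : Finset V) (S : Finset (Edge V)),
      A.card = k + 1 ∧ S ⊆ F ∧ S ⊆ inside A ∧ S.card = k ∧ Conn S A := by
    intro k
    induction k with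
    | zero =>
      intro _
      obtain ⟨v⟩ := ‹Nonempty V›
      refine ⟨{v}, ∅, by simp, by simp, by simp, by simp, ?_⟩
      rintro X ⟨p, hp⟩ ⟨q, hq⟩
      simp only [Finset.mem_inter, Finset.mem_sdiff, Finset.mem_singleton] at hp hq
      exact absurd (hq.1.trans hp.1.symm ▸ hp.2) hq.2
    | succ k ih =>
      intro hk
      obtain ⟨A, S, hA, hSF, hSA, hS, hc⟩ := ih (by omega)
      have hne : A.Nonempty := by rw [← Finset.card_pos]; omega
      have hne' : (Finset.univ \ A).Nonempty := by
        rw [← Finset.card_pos, Finset.card_sdiff_of_subset (Finset.subset_univ A),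
          Finset.card_univ]
        omega
      obtain ⟨e, heF, -, heA⟩ := hF A (by simpa using hne) hne'
      obtain ⟨v, hvA, heI, heI'⟩ : ∃ v, v ∉ A ∧ e ∈ inside (insert v A) ∧ e ∉ inside A := by
        obtain ⟨u, v, huv, rfl⟩ := e.exists_eq
        simp only [mem_inside, mem_cut, Finset.mem_insert] at heA ⊢
        rcases heA with ⟨h1, h2⟩ | ⟨h1, h2⟩
        · exact ⟨v, h2, by simp [h1], by simp [h2]⟩
        · exact ⟨u, h2, by simp [h1], by simp [h2]⟩
      refine ⟨insert v A, insert e S, by rw [Finset.card_insert_of_notMem hvA, hA],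
        Finset.insert_subset heF hSF,
        Finset.insert_subset heI (hSA.trans (inside_mono (Finset.subset_insert v A))), ?_,
        hc.insert_vertex heA heI⟩
      rw [Finset.card_insert_of_notMem (fun h => heI' (hSA h)), hS]
  have hpos := Fintype.card_pos (α := V)
  obtain ⟨A, S, hA, hSF, -, hS, hc⟩ := key (Fintype.card V - 1) (by omega)
  have hAu : A = Finset.univ := by
    rw [← Finset.card_eq_iff_eq_univ]; omega
  subst hAu
  exact ⟨S, hSF, hc, by omega⟩

/-! ### Trees in the minimal face. -/

/-- `S` is a spanning tree in the minimal face containing `y`. -/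
structure IsFaceTree (y : Edge V → ℝ) (σ : ℝ) (S : Finset (Edge V)) : Prop where
  tree : IsTreeSet S
  pos : ∀ e ∈ S, 0 < y e
  conn : ∀ A, IsTight y σ A → Conn S A

theorem InCone.tight_univ [Nonempty V] {y : Edge V → ℝ} {σ : ℝ} (hy : InCone y σ) :
    IsTight y σ Finset.univ := ⟨Finset.univ_nonempty, hy.gap_univ⟩

theorem InCone.exists_min_tight [Nonempty V] {y : Edge V → ℝ} {σ : ℝ} (hy : InCone y σ)
    (e : Edge V) : ∃ A, IsTight y σ A ∧ e ∈ inside A ∧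
      ∀ B, IsTight y σ B → e ∈ inside B → A ⊆ B := by
  classical
  obtain ⟨A, hA, hmin⟩ := Finset.exists_min_image
    (Finset.univ.filter fun A => IsTight y σ A ∧ e ∈ inside A) Finset.card
    ⟨Finset.univ, by simp [hy.tight_univ]⟩
  simp only [Finset.mem_filter, Finset.mem_univ, true_and] at hA hmin
  refine ⟨A, hA.1, hA.2, fun B hB heB => ?_⟩
  have heAB : e ∈ inside (A ∩ B) := by
    rw [inside_inter]; exact Finset.mem_inter.2 ⟨hA.2, heB⟩
  have hne : (A ∩ B).Nonempty := by
    obtain ⟨u, v, huv, rfl⟩ := e.exists_eq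
    exact ⟨u, (mem_inside.1 heAB).1⟩
  have h := hmin (A ∩ B) ⟨(hy.tight_inter_union hA.1 hB hne).1, heAB⟩
  exact Finset.inter_eq_left.1 (Finset.eq_of_subset_of_card_le Finset.inter_subset_left h)

theorem sum_exchange {M : Type*} [AddCommMonoid M] {S : Finset (Edge V)} {e f : Edge V}
    {X : Finset V} (hX : S ∩ cut X = {e}) (hf : f ∈ cut X) (hfe : f ≠ e) (t : Edge V → M) :
    (∑ g ∈ insert f (S.erase e), t g) + t e = (∑ g ∈ S, t g) + t f := by
  have heS : e ∈ S := (Finset.mem_inter.1 (hX ▸ Finset.mem_singleton_self e)).1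
  have hfS : f ∉ S := fun h => hfe (by
    have : f ∈ S ∩ cut X := Finset.mem_inter.2 ⟨h, hf⟩
    rwa [hX, Finset.mem_singleton] at this)
  rw [Finset.sum_insert (fun h => hfS (Finset.mem_of_mem_erase h)), add_assoc,
    Finset.sum_erase_add _ _ heS, add_comm]

/-- A tight set that contains the old edge contains A, hence the new edge, so its edge count does
not drop. A tight set without the old edge keeps all its tree edges. -/
theorem IsFaceTree.exchange {y : Edge V → ℝ} {σ : ℝ} {S : Finset (Edge V)}
    (hS : IsFaceTree y σ S) {e f : Edge V} {X A : Finset V} (hX : S ∩ cut X = {e})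
    (hA : ∀ B, IsTight y σ B → e ∈ inside B → A ⊆ B)
    (hf : f ∈ cut X) (hfA : f ∈ inside A) (hfy : 0 < y f) (hfe : f ≠ e) :
    IsFaceTree y σ (insert f (S.erase e)) := by
  have htree := hS.tree.exchange hX hf hfe
  refine ⟨htree, ?_, ?_⟩
  · intro g hg
    rcases Finset.mem_insert.1 hg with rfl | hg
    · exact hfy
    · exact hS.pos g (Finset.mem_of_mem_erase hg)
  · intro B hB
    by_cases heB : e ∈ inside B
    · rw [htree.conn_iff hB.1]
      have h1 := (hS.tree.conn_iff hB.1).1 (hS.conn B hB)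
      have h2 := sum_exchange hX hf hfe (fun g => if g ∈ inside B then 1 else 0)
      have hfB : f ∈ inside B := inside_mono (hA B hB heB) hfA
      simp only [heB, hfB, if_true, ← Finset.card_filter, Finset.filter_mem_eq_inter] at h2
      omega
    · refine (hS.conn B hB).mono fun g hg hgB => ?_
      refine Finset.mem_insert_of_mem (Finset.mem_erase.2 ⟨?_, hg⟩)
      rintro rfl
      exact heB hgB

/-- Among trees in the support, one maximising the number of pairs of a tree edge and a tight set
containing it is extremal. A minimal tight set that it fails to connect permits an improving
exchange or contradicts uncrossing. -/
theorem InCone.exists_isFaceTree [Nonempty V] {y : Edge V → ℝ} {σ : ℝ} (hσ : 0 < σ)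
    (hy : InCone y σ) : ∃ S, IsFaceTree y σ S := by
  classical
  set t : Edge V → ℕ := fun g =>
    (Finset.univ.filter fun B => IsTight y σ B ∧ g ∈ inside B).card with ht
  obtain ⟨S₀, hS₀, hS₀t⟩ : ∃ S ⊆ Finset.univ.filter (fun e => 0 < y e), IsTreeSet S := by
    apply Conn.exists_isTreeSet
    intro X h1 h2
    obtain ⟨e, he, hpos⟩ := hy.exists_crossing (by rw [hy.gap_univ]; exact hσ) h1 h2
    rw [Finset.mem_inter] at he
    exact ⟨e, by simpa using hpos, he.1, he.2⟩
  obtain ⟨S, hS, hmax⟩ := Finset.exists_max_image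
    (Finset.univ.filter fun S : Finset (Edge V) => IsTreeSet S ∧ ∀ e ∈ S, 0 < y e)
    (fun S => ∑ g ∈ S, t g)
    ⟨S₀, by
      simp only [Finset.mem_filter, Finset.mem_univ, true_and]
      exact ⟨hS₀t, fun e he => by simpa using hS₀ he⟩⟩
  simp only [Finset.mem_filter, Finset.mem_univ, true_and] at hS hmax
  obtain ⟨hS, hpos⟩ := hS
  refine ⟨S, hS, hpos, ?_⟩
  by_contra! hbad
  obtain ⟨A, hA, hmin⟩ := Finset.exists_min_image
    (Finset.univ.filter fun A => IsTight y σ A ∧ ¬ Conn S A) Finset.card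
    (by obtain ⟨A, h1, h2⟩ := hbad; exact ⟨A, by simp [h1, h2]⟩)
  simp only [Finset.mem_filter, Finset.mem_univ, true_and] at hA hmin
  obtain ⟨hA, hAc⟩ := hA
  have hproper : ∀ B, IsTight y σ B → B ⊆ A → ¬ A ⊆ B → Conn S B := by
    intro B hB hBA hAB
    by_contra hc
    exact absurd (hmin B ⟨hB, hc⟩) (not_le.2 (Finset.card_lt_card ⟨hBA, hAB⟩))
  unfold Conn at hAc
  push Not at hAc
  obtain ⟨X, ⟨v, hv⟩, ⟨w, hw⟩, hX⟩ := hAc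
  rw [Finset.mem_inter] at hv
  rw [Finset.mem_sdiff] at hw
  have hside : ∀ B, B ⊆ A → Conn S B → ∀ p ∈ B, p ∈ X → ∀ q ∈ B, q ∈ X := by
    intro B hBA hB p hp hpX q hq
    by_contra hqX
    obtain ⟨e, he, heB, heX⟩ := hB X ⟨p, by simp [hp, hpX]⟩ ⟨q, by simp [hq, hqX]⟩
    exact hX e he (inside_mono hBA heB) heX
  -- R enlarges A ∩ X by all tight sets that meet it without containing A. By minimality of A it
  -- gains no vertex of A \ X, so the tree path from v to w must leave R.
  set R : Finset V := Finset.univ.filter fun q => (q ∈ A ∧ q ∈ X) ∨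
    ∃ U, IsTight y σ U ∧ ¬ A ⊆ U ∧ q ∈ U ∧ ∃ p ∈ U, p ∈ A ∧ p ∈ X with hR
  have hUA : ∀ U, IsTight y σ U → ¬ A ⊆ U → ∀ p ∈ U, p ∈ A → p ∈ X →
      ∀ q ∈ U, q ∈ A → q ∈ X := by
    intro U hU hAU p hp hpA hpX q hq hqA
    have h := hy.tight_inter_union hA hU ⟨p, by simp [hp, hpA]⟩
    have h2 := hproper (A ∩ U) h.1 Finset.inter_subset_left
      (fun h => hAU (h.trans Finset.inter_subset_right))
    exact hside _ Finset.inter_subset_left h2 p (by simp [hp, hpA]) hpX q (by simp [hq, hqA])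
  have hRA : ∀ q ∈ R, q ∈ A → q ∈ X := by
    intro q hq hqA
    simp only [hR, Finset.mem_filter, Finset.mem_univ, true_and] at hq
    rcases hq with hq | ⟨U, hU, hAU, hqU, p, hpU, hpA, hpX⟩
    · exact hq.2
    · exact hUA U hU hAU p hpU hpA hpX q hqU hqA
  obtain ⟨e, heS, heR, Z, hZ, hvZ, hwZ⟩ := hS.exists_path_edge (v := v) (w := w) _ R rfl
    (by simp [hR, hv]) (fun h => hw.2 (hRA w h hw.1))
  by_cases heA : e ∈ inside A
  · apply hX e heS heA
    obtain ⟨a, b, hab, rfl⟩ := e.exists_eq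
    rw [mem_inside] at heA
    rw [mem_cut] at heR ⊢
    have hXR : ∀ q, q ∈ A → q ∈ X → q ∈ R := by
      intro q h1 h2; simp [hR, h1, h2]
    rcases heR with ⟨h1, h2⟩ | ⟨h1, h2⟩
    · exact Or.inl ⟨hRA a h1 heA.1, fun h => h2 (hXR b heA.2 h)⟩
    · exact Or.inr ⟨hRA b h1 heA.2, fun h => h2 (hXR a heA.1 h)⟩
  -- Otherwise every tight set containing `e` contains A. Replacing `e` by a support edge inside A
  -- would then increase the count, A itself being a new tight set gained.
  · obtain ⟨B, hB, heB, hAB⟩ : ∃ B, IsTight y σ B ∧ e ∈ inside B ∧ ¬ A ⊆ B := by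
      by_contra! hc
      obtain ⟨f, hf, hfy⟩ := hy.exists_crossing (A := A) (X := Z) (by rw [hA.2]; exact hσ)
        ⟨v, by simp [hv, hvZ]⟩ ⟨w, by simp [hw, hwZ]⟩
      rw [Finset.mem_inter] at hf
      have hfe : f ≠ e := by rintro rfl; exact heA hf.1
      have h1 := hmax _ ⟨hS.exchange hZ hf.2 hfe, by
        intro g hg
        rcases Finset.mem_insert.1 hg with rfl | hg
        · exact hfy
        · exact hpos g (Finset.mem_of_mem_erase hg)⟩
      have h2 := sum_exchange hZ hf.2 hfe t
      have h3 : t e < t f := by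
        apply Finset.card_lt_card
        refine ⟨?_, ?_⟩
        · intro B hB
          simp only [Finset.mem_filter, Finset.mem_univ, true_and] at hB ⊢
          exact ⟨hB.1, inside_mono (hc B hB.1 hB.2) hf.1⟩
        · intro h
          have h4 : A ∈ Finset.univ.filter fun B => IsTight y σ B ∧ f ∈ inside B := by
            simp [hA, hf.1]
          exact heA (by simpa using (Finset.mem_filter.1 (h h4)).2.2)
      omega
    obtain ⟨a, b, haR, hbR, haB, hbB⟩ : ∃ a b, a ∈ R ∧ b ∉ R ∧ a ∈ B ∧ b ∈ B := by
      obtain ⟨a, b, hab, rfl⟩ := e.exists_eq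
      rw [mem_inside] at heB
      rw [mem_cut] at heR
      rcases heR with h | h
      · exact ⟨a, b, h.1, h.2, heB.1, heB.2⟩
      · exact ⟨b, a, h.1, h.2, heB.2, heB.1⟩
    apply hbR
    simp only [hR, Finset.mem_filter, Finset.mem_univ, true_and] at haR ⊢
    right
    rcases haR with ha | ⟨U, hU, hAU, haU, p, hpU, hpA, hpX⟩
    · exact ⟨B, hB, hAB, hbB, a, haB, ha.1, ha.2⟩
    · have hW := hy.tight_inter_union hU hB ⟨a, by simp [haU, haB]⟩
      -- If U ∪ B covered A, then U and B would split A into its X part and the rest. Tightness of A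
      -- gives a support edge between these parts, while uncrossing U and B gives such edges weight
      -- zero.
      refine ⟨U ∪ B, hW.2.1, ?_, by simp [hbB], p, by simp [hpU], hpA, hpX⟩
      intro hAUB
      have hAU' : ∀ q ∈ A, q ∈ U → q ∈ X := fun q hq hqU =>
        hUA U hU hAU p hpU hpA hpX q hqU hq
      have hwB : w ∈ B := by
        rcases Finset.mem_union.1 (hAUB hw.1) with h | h
        · exact absurd (hAU' w hw.1 h) hw.2
        · exact h
      have hAB' : ∀ q ∈ A, q ∈ B → q ∉ X := fun q hq hqB hqX =>
        hw.2 (hUA B hB hAB q hqB hq hqX w hwB hw.1)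
      obtain ⟨f, hf, hfy⟩ := hy.exists_crossing (A := A) (X := U) (by rw [hA.2]; exact hσ)
        ⟨p, by simp [hpA, hpU]⟩ ⟨w, by
          rw [Finset.mem_sdiff]; exact ⟨hw.1, fun h => hw.2 (hAU' w hw.1 h)⟩⟩
      have hfb : f ∈ btw (U \ B) (B \ U) := by
        rw [Finset.mem_inter] at hf
        obtain ⟨c, d, hcd, rfl⟩ := f.exists_eq
        rw [mem_inside, mem_cut] at hf
        simp only [mem_btw, Finset.mem_sdiff]
        rcases hf.2 with ⟨h1, h2⟩ | ⟨h1, h2⟩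
        · exact Or.inl ⟨⟨h1, fun h => hAB' c hf.1.1 h (hAU' c hf.1.1 h1)⟩,
            (Finset.mem_union.1 (hAUB hf.1.2)).resolve_left h2, h2⟩
        · exact Or.inr ⟨⟨h1, fun h => hAB' d hf.1.2 h (hAU' d hf.1.2 h1)⟩,
            (Finset.mem_union.1 (hAUB hf.1.1)).resolve_left h2, h2⟩
      have h0 := hW.2.2
      have h1 := (Finset.sum_eq_zero_iff_of_nonneg (fun e _ => hy.nonneg e)).1 h0 f hfb
      exact absurd h1 hfy.ne'

/-! ### Layered trees of minimum rise. -/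

/-- The vertices of level at most `j`. -/
def below (ℓ : V → ℕ) (j : ℕ) : Finset V := Finset.univ.filter fun v => ℓ v ≤ j

/-- The vertices of level between `a` and `b`. -/
def slab (ℓ : V → ℕ) (a b : ℕ) : Finset V := Finset.univ.filter fun v => a ≤ ℓ v ∧ ℓ v ≤ b

/-- The number of levels an edge rises. -/
def rise (ℓ : V → ℕ) (e : Edge V) : ℕ :=
  Sym2.lift ⟨fun u v => max (ℓ u) (ℓ v) - min (ℓ u) (ℓ v), fun u v => by
    dsimp only; rw [max_comm, min_comm]⟩ e.1

theorem rise_mk (ℓ : V → ℕ) {u v : V} (h : ¬ s(u, v).IsDiag) :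
    rise ℓ ⟨s(u, v), h⟩ = max (ℓ u) (ℓ v) - min (ℓ u) (ℓ v) := rfl

@[simp] theorem mem_below {ℓ : V → ℕ} {j : ℕ} {v : V} : v ∈ below ℓ j ↔ ℓ v ≤ j := by
  simp [below]

@[simp] theorem mem_slab {ℓ : V → ℕ} {a b : ℕ} {v : V} :
    v ∈ slab ℓ a b ↔ a ≤ ℓ v ∧ ℓ v ≤ b := by
  simp [slab]

/-- Take vertices of A on opposite sides of X with levels as close as possible. If these differ by
at most one, the slab bound supplies the edge. Otherwise A has no vertex strictly between the two
levels, so edges of total weight at least σ jump over a level. -/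
theorem InCone.exists_low_crossing {y : Edge V → ℝ} {σ : ℝ} (hy : InCone y σ)
    {ℓ : V → ℕ} (hslab : ∀ a b, b ≤ a + 1 → gap y σ (slab ℓ a b) < σ)
    (hskip : ∀ a, weight y (btw (below ℓ a) (Finset.univ.filter fun v => a + 2 ≤ ℓ v)) < σ)
    {A X : Finset V} (hA : IsTight y σ A) (h1 : (A ∩ X).Nonempty) (h2 : (A \ X).Nonempty) :
    ∃ f ∈ inside A, f ∈ cut X ∧ 0 < y f ∧ rise ℓ f ≤ 1 := by
  obtain ⟨⟨p, q⟩, hpq, hmin⟩ := Finset.exists_min_image ((A ∩ X) ×ˢ (A \ X))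
    (fun r => max (ℓ r.1) (ℓ r.2) - min (ℓ r.1) (ℓ r.2)) (h1.product h2)
  simp only [Finset.mem_product, Finset.mem_inter, Finset.mem_sdiff] at hpq hmin
  set a := min (ℓ p) (ℓ q) with ha
  set b := max (ℓ p) (ℓ q) with hb
  by_cases hab : b ≤ a + 1
  · obtain ⟨f, hf, hfy⟩ := hy.exists_crossing (A := A ∩ slab ℓ a b) (X := X)
      ((hy.gap_inter_le hA).trans_lt (hslab a b hab))
      ⟨p, by simp [hpq.1.1, hpq.1.2, ha, hb]⟩ ⟨q, by simp [hpq.2.1, hpq.2.2, ha, hb]⟩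
    rw [inside_inter, Finset.mem_inter, Finset.mem_inter] at hf
    refine ⟨f, hf.1.1, hf.2, hfy, ?_⟩
    have h := hf.1.2
    obtain ⟨u, v, huv, rfl⟩ := f.exists_eq
    rw [mem_inside, mem_slab, mem_slab] at h
    rw [rise_mk]
    omega
  · exfalso
    have hgap : ∀ r ∈ A, ℓ r ≤ a ∨ b ≤ ℓ r := by
      intro r hr
      by_contra! hc
      by_cases hrX : r ∈ X
      · have := hmin (r, q) ⟨⟨hr, hrX⟩, hpq.2⟩
        simp only at this
        omega
      · have := hmin (p, r) ⟨hpq.1, ⟨hr, hrX⟩⟩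
        simp only at this
        omega
    have hlow : (A ∩ below ℓ a).Nonempty := by
      rcases le_total (ℓ p) (ℓ q) with h | h
      · exact ⟨p, by simp [hpq.1.1, ha, h]⟩
      · exact ⟨q, by simp [hpq.2.1, ha, h]⟩
    have hhigh : (A \ below ℓ a).Nonempty := by
      rcases le_total (ℓ p) (ℓ q) with h | h
      · exact ⟨q, by simp only [Finset.mem_sdiff, mem_below]; exact ⟨hpq.2.1, by omega⟩⟩
      · exact ⟨p, by simp only [Finset.mem_sdiff, mem_below]; exact ⟨hpq.1.1, by omega⟩⟩
    have h3 := hy.le_weight_crossing hA hlow hhigh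
    have h4 : inside A ∩ cut (below ℓ a) ⊆
        btw (below ℓ a) (Finset.univ.filter fun v => a + 2 ≤ ℓ v) := by
      intro f hf
      obtain ⟨u, v, huv, rfl⟩ := f.exists_eq
      simp only [Finset.mem_inter, mem_inside, mem_cut, mem_btw, mem_below, Finset.mem_filter,
        Finset.mem_univ, true_and] at hf ⊢
      have hu := hgap u hf.1.1
      have hv := hgap v hf.1.2
      omega
    have h5 := weight_mono hy.nonneg h4
    exact absurd (hskip a) (not_lt.2 (h3.trans h5))

theorem InCone.exists_faceTree_layered [Nonempty V] {y : Edge V → ℝ} {σ : ℝ} (hσ : 0 < σ)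
    (hy : InCone y σ) {ℓ : V → ℕ} (hcut : ∀ j, weight y (cut (below ℓ j)) < 2 * σ)
    (hslab : ∀ a b, b ≤ a + 1 → gap y σ (slab ℓ a b) < σ)
    (hskip : ∀ a, weight y (btw (below ℓ a) (Finset.univ.filter fun v => a + 2 ≤ ℓ v)) < σ) :
    ∃ S, IsFaceTree y σ S ∧ ∀ j, (S ∩ cut (below ℓ j)).card ≤ 1 := by
  classical
  obtain ⟨S₀, hS₀⟩ := hy.exists_isFaceTree hσ
  obtain ⟨S, hS, hmin⟩ := Finset.exists_min_image
    (Finset.univ.filter fun S => IsFaceTree y σ S) (fun S => ∑ g ∈ S, rise ℓ g)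
    ⟨S₀, by simp [hS₀]⟩
  simp only [Finset.mem_filter, Finset.mem_univ, true_and] at hS hmin
  have hopt : ∀ (e f : Edge V) (X A : Finset V), S ∩ cut X = {e} →
      (∀ B, IsTight y σ B → e ∈ inside B → A ⊆ B) → f ∈ cut X → f ∈ inside A → 0 < y f →
      rise ℓ e ≤ rise ℓ f := by
    intro e f X A hX hA hf hfA hfy
    by_cases hfe : f = e
    · rw [hfe]
    · have h1 := hmin _ (hS.exchange hX hA hf hfA hfy hfe)
      have h2 := sum_exchange hX hf hfe (rise ℓ)
      omega
  have hrise : ∀ e ∈ S, rise ℓ e ≤ 1 := by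
    intro e he
    obtain ⟨X, hX⟩ := hS.tree.exists_side he
    obtain ⟨A, hA, heA, hAmin⟩ := hy.exists_min_tight e
    have heX : e ∈ cut X := (Finset.mem_inter.1 (hX ▸ Finset.mem_singleton_self e)).2
    obtain ⟨f, hfA, hfX, hfy, hf1⟩ := hy.exists_low_crossing hslab hskip (X := X) hA
      (by
        obtain ⟨u, v, huv, rfl⟩ := e.exists_eq
        rw [mem_inside] at heA
        rw [mem_cut] at heX
        rcases heX with h | h
        · exact ⟨u, by simp [heA, h]⟩
        · exact ⟨v, by simp [heA, h]⟩)
      (by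
        obtain ⟨u, v, huv, rfl⟩ := e.exists_eq
        rw [mem_inside] at heA
        rw [mem_cut] at heX
        rcases heX with h | h
        · exact ⟨v, by simp [heA, h]⟩
        · exact ⟨u, by simp [heA, h]⟩)
    exact (hopt e f X A hX hAmin hfX hfA hfy).trans hf1
  refine ⟨S, hS, fun j => ?_⟩
  have huniq : ∀ e ∈ S, e ∈ cut (below ℓ j) → ∀ A, IsTight y σ A → e ∈ inside A →
      (∀ B, IsTight y σ B → e ∈ inside B → A ⊆ B) →
      ∀ g ∈ S, g ∈ cut (below ℓ j) → g ∈ inside A → g = e := by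
    intro e he hej A hA heA hAmin g hg hgj hgA
    obtain ⟨X, hX⟩ := hS.tree.exists_side he
    have heX : e ∈ cut X := (Finset.mem_inter.1 (hX ▸ Finset.mem_singleton_self e)).2
    -- If X separated two vertices of A on one level, a level edge could replace `e`, which rises,
    -- contradicting minimality.
    have hlevel : ∀ p ∈ A, ∀ q ∈ A, ℓ p = ℓ q → p ∈ X → q ∈ X := by
      intro p hp q hq hpq hpX
      by_contra hqX
      obtain ⟨f, hf, hfy⟩ := hy.exists_crossing (A := A ∩ slab ℓ (ℓ p) (ℓ p)) (X := X)
        ((hy.gap_inter_le hA).trans_lt (hslab _ _ (Nat.le_succ _)))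
        ⟨p, by simp [hp, hpX]⟩ ⟨q, by simp [hq, hqX, hpq]⟩
      rw [inside_inter, Finset.mem_inter, Finset.mem_inter] at hf
      have h1 := hopt e f X A hX hAmin hf.2 hf.1.1 hfy
      have h2 : rise ℓ f = 0 := by
        have h := hf.1.2
        obtain ⟨u, v, huv, rfl⟩ := f.exists_eq
        rw [mem_inside, mem_slab, mem_slab] at h
        rw [rise_mk]
        omega
      have h3 : 0 < rise ℓ e := by
        obtain ⟨u, v, huv, rfl⟩ := e.exists_eq
        rw [mem_cut, mem_below, mem_below] at hej
        rw [rise_mk]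
        omega
      omega
    suffices g ∈ cut X by
      have h : g ∈ S ∩ cut X := Finset.mem_inter.2 ⟨hg, this⟩
      rwa [hX, Finset.mem_singleton] at h
    have h1 := hrise e he
    have h2 := hrise g hg
    obtain ⟨u, v, huv, rfl⟩ := e.exists_eq
    obtain ⟨a, b, hab, rfl⟩ := g.exists_eq
    rw [rise_mk] at h1 h2
    rw [mem_cut, mem_below, mem_below] at hej hgj
    rw [mem_inside] at heA hgA
    rw [mem_cut] at heX ⊢
    -- Both edges cross level j and rise at most one, so each joins level j to level j + 1.
    have hsame : (ℓ u = ℓ a ∧ ℓ v = ℓ b) ∨ (ℓ u = ℓ b ∧ ℓ v = ℓ a) := by omega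
    have k1 := hlevel u heA.1
    have k2 := hlevel v heA.2
    rcases hsame with ⟨h3, h4⟩ | ⟨h3, h4⟩
    · have i1 := k1 a hgA.1 h3
      have i2 := hlevel a hgA.1 u heA.1 h3.symm
      have i3 := k2 b hgA.2 h4
      have i4 := hlevel b hgA.2 v heA.2 h4.symm
      rcases heX with h | h
      · exact Or.inl ⟨i1 h.1, fun hb => h.2 (i4 hb)⟩
      · exact Or.inr ⟨i3 h.1, fun ha => h.2 (i2 ha)⟩
    · have i1 := k1 b hgA.2 h3
      have i2 := hlevel b hgA.2 u heA.1 h3.symm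
      have i3 := k2 a hgA.1 h4
      have i4 := hlevel a hgA.1 v heA.2 h4.symm
      rcases heX with h | h
      · exact Or.inr ⟨i1 h.1, fun hb => h.2 (i4 hb)⟩
      · exact Or.inl ⟨i3 h.1, fun ha => h.2 (i2 ha)⟩
  rw [Finset.card_le_one]
  intro e he g hg
  rw [Finset.mem_inter] at he hg
  by_contra hne
  obtain ⟨A, hA, heA, hAmin⟩ := hy.exists_min_tight e
  obtain ⟨B, hB, hgB, hBmin⟩ := hy.exists_min_tight g
  have hheavy : ∀ (e : Edge V) (A : Finset V), IsTight y σ A → e ∈ inside A →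
      e ∈ cut (below ℓ j) → σ ≤ weight y (inside A ∩ cut (below ℓ j)) := by
    intro e A hA heA he
    obtain ⟨u, v, huv, rfl⟩ := e.exists_eq
    rw [mem_inside] at heA
    rw [mem_cut] at he
    refine hy.le_weight_crossing hA ?_ ?_
    · rcases he with h | h
      · exact ⟨u, Finset.mem_inter.2 ⟨heA.1, h.1⟩⟩
      · exact ⟨v, Finset.mem_inter.2 ⟨heA.2, h.1⟩⟩
    · rcases he with h | h
      · exact ⟨v, Finset.mem_sdiff.2 ⟨heA.2, h.2⟩⟩
      · exact ⟨u, Finset.mem_sdiff.2 ⟨heA.1, h.2⟩⟩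
  have hdisj : Disjoint (inside A ∩ cut (below ℓ j)) (inside B ∩ cut (below ℓ j)) := by
    rw [Finset.disjoint_left]
    intro f hfA hfB
    rw [Finset.mem_inter] at hfA hfB
    have hfAB : f ∈ inside (A ∩ B) := by
      rw [inside_inter]; exact Finset.mem_inter.2 ⟨hfA.1, hfB.1⟩
    have hends : (A ∩ B ∩ below ℓ j).Nonempty ∧ ((A ∩ B) \ below ℓ j).Nonempty := by
      have hfj := hfA.2
      obtain ⟨u, v, huv, rfl⟩ := f.exists_eq
      rw [mem_inside] at hfAB
      rw [mem_cut] at hfj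
      rcases hfj with h | h
      · exact ⟨⟨u, Finset.mem_inter.2 ⟨hfAB.1, h.1⟩⟩, ⟨v, Finset.mem_sdiff.2 ⟨hfAB.2, h.2⟩⟩⟩
      · exact ⟨⟨v, Finset.mem_inter.2 ⟨hfAB.2, h.1⟩⟩, ⟨u, Finset.mem_sdiff.2 ⟨hfAB.1, h.2⟩⟩⟩
    -- A common crossing edge makes A ∩ B tight on both sides of the cut. The tree connects A ∩ B,
    -- and its crossing edge there must equal both `e` and `g`.
    have htight := (hy.tight_inter_union hA hB (hends.1.mono Finset.inter_subset_left)).1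
    obtain ⟨k, hk, hkAB, hkj⟩ := hS.conn _ htight _ hends.1 hends.2
    rw [inside_inter, Finset.mem_inter] at hkAB
    have h1 := huniq e he.1 he.2 A hA heA hAmin k hk hkj hkAB.1
    have h2 := huniq g hg.1 hg.2 B hB hgB hBmin k hk hkj hkAB.2
    exact hne (h1.symm.trans h2)
  have h1 := hheavy e A hA heA he.2
  have h2 := hheavy g B hB hgB hg.2
  have h3 : weight y (inside A ∩ cut (below ℓ j)) + weight y (inside B ∩ cut (below ℓ j)) ≤
      weight y (cut (below ℓ j)) := by
    unfold weight
    rw [← Finset.sum_union hdisj]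
    exact weight_mono hy.nonneg
      (Finset.union_subset Finset.inter_subset_right Finset.inter_subset_right)
  linarith [hcut j]

/-! ### Feasible solutions and their chain of narrow cuts. -/

theorem sum_degree (y : Edge V → ℝ) (A : Finset V) :
    ∑ v ∈ A, weight y (cut {v}) = 2 * weight y (inside A) + weight y (cut A) := by
  simp only [weight_eq_sum, Finset.mul_sum, ← Finset.sum_add_distrib]
  rw [Finset.sum_comm]
  refine Finset.sum_congr rfl fun e _ => ?_
  obtain ⟨u, w, huw, rfl⟩ := e.exists_eq
  have hne : u ≠ w := by simpa using huw
  have h : ∀ v ∈ A, (if (⟨s(u, w), huw⟩ : Edge V) ∈ cut {v} then y ⟨s(u, w), huw⟩ else 0) =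
      (if u = v then y ⟨s(u, w), huw⟩ else 0) + (if w = v then y ⟨s(u, w), huw⟩ else 0) := by
    intro v _
    simp only [mem_cut, Finset.mem_singleton]
    by_cases h1 : u = v <;> by_cases h2 : w = v
    · exact absurd (h1.trans h2.symm) hne
    · simp [h1, h2]
    · simp [h1, h2]
    · simp [h1, h2]
  rw [Finset.sum_congr rfl h, Finset.sum_add_distrib, Finset.sum_ite_eq, Finset.sum_ite_eq]
  simp only [mem_inside, mem_cut]
  by_cases h1 : u ∈ A <;> by_cases h2 : w ∈ A <;> simp [h1, h2, two_mul]

variable {s t : V} {x : Edge V → ℝ}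

/-- The degree sum over A is 2|A| - |A ∩ {s,t}|; it counts inner edges twice and cut edges once. -/
theorem IsFeasible.gap_eq (hst : s ≠ t) (hx : IsFeasible s t x) (A : Finset V) :
    gap x 1 A = weight x (cut A) / 2 + ((A ∩ {s, t}).card : ℝ) / 2 - 1 := by
  have h1 := sum_degree x A
  have h2 : ∀ v ∈ A, weight x (cut {v}) =
      2 - (if s = v then 1 else 0) - (if t = v then 1 else 0) := by
    intro v _
    by_cases hs : s = v
    · subst hs
      rw [hx.degree_left, if_pos rfl, if_neg (Ne.symm hst)]; norm_num
    · by_cases ht : t = v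
      · subst ht
        rw [hx.degree_right, if_neg hs, if_pos rfl]; norm_num
      · rw [hx.degree_inner v (Ne.symm hs) (Ne.symm ht), if_neg hs, if_neg ht]; norm_num
  rw [Finset.sum_congr rfl h2, Finset.sum_sub_distrib, Finset.sum_sub_distrib,
    Finset.sum_ite_eq, Finset.sum_ite_eq, Finset.sum_const, nsmul_eq_mul] at h1
  have h3 : ((A ∩ {s, t}).card : ℝ) = (if s ∈ A then 1 else 0) + (if t ∈ A then 1 else 0) := by
    by_cases hs : s ∈ A <;> by_cases ht : t ∈ A <;>
      simp [hs, ht, Finset.inter_insert_of_mem, Finset.inter_insert_of_notMem,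
        Finset.inter_singleton_of_mem, Finset.inter_singleton_of_notMem, hst, one_add_one_eq_two]
  rw [h3]
  unfold gap
  linarith

theorem cut_univ : cut (Finset.univ : Finset V) = ∅ := by
  ext e
  obtain ⟨u, v, huv, rfl⟩ := e.exists_eq
  simp [mem_cut]

theorem IsFeasible.inCone (hst : s ≠ t) (hx : IsFeasible s t x) : InCone x 1 where
  nonneg := hx.nonneg
  gap_nonneg A hA := by
    rw [hx.gap_eq hst]
    have hle : (A ∩ {s, t}).card ≤ 2 :=
      (Finset.card_le_card Finset.inter_subset_right).trans Finset.card_le_two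
    by_cases hu : A = Finset.univ
    · subst hu
      rw [cut_univ, Finset.univ_inter, Finset.card_pair hst]
      simp [weight]
    · rcases Nat.even_or_odd (A ∩ {s, t}).card with h | h
      · have h1 := hx.even_cut A hA hu h
        have h2 : (0 : ℝ) ≤ ((A ∩ {s, t}).card : ℝ) := Nat.cast_nonneg _
        linarith
      · have h1 := hx.odd_cut A hA hu h
        have h2 : (1 : ℝ) ≤ ((A ∩ {s, t}).card : ℝ) := by exact_mod_cast h.pos
        linarith
  gap_univ := by
    rw [hx.gap_eq hst, cut_univ, Finset.univ_inter, Finset.card_pair hst]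
    simp [weight]

/-- `L` separates `s` from `t` and its cut has value less than `θ`. -/
structure IsNarrow (s t : V) (x : Edge V → ℝ) (θ : ℝ) (L : Finset V) : Prop where
  left : s ∈ L
  right : t ∉ L
  lt : weight x (cut L) < θ

theorem weight_cut_diff_of_subset (y : Edge V → ℝ) {L M : Finset V} (h : L ⊆ M) :
    weight y (cut L) + weight y (cut M) =
      weight y (cut (M ∩ Lᶜ)) + 2 * weight y (btw L Mᶜ) := by
  simp only [weight_eq_sum, ← Finset.sum_add_distrib, Finset.mul_sum]
  refine Finset.sum_congr rfl fun e _ => ?_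
  obtain ⟨u, v, huv, rfl⟩ := e.exists_eq
  have hu := @h u
  have hv := @h v
  simp only [mem_cut, mem_btw, Finset.mem_inter, Finset.mem_compl]
  by_cases h1 : u ∈ L <;> by_cases h2 : u ∈ M <;> by_cases h3 : v ∈ L <;> by_cases h4 : v ∈ M <;>
    simp [h1, h2, h3, h4] at hu hv ⊢ <;> ring

/-- Uncross L with the complement of M. Each has slack below 1/2, while their union contains s and t
and is proper, so it has slack at least 1. -/
theorem IsNarrow.total (hst : s ≠ t) (hx : IsFeasible s t x) {L M : Finset V}
    (hL : IsNarrow s t x 2 L) (hM : IsNarrow s t x 2 M) : L ⊆ M ∨ M ⊆ L := by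
  by_contra! hc
  have hcone := hx.inCone hst
  have h := gap_uncross x 1 L Mᶜ
  have h0 := weight_nonneg hx.nonneg (btw (L \ Mᶜ) (Mᶜ \ L))
  obtain ⟨⟨p, hpL, hpM⟩, q, hqM, hqL⟩ : (∃ p ∈ L, p ∉ M) ∧ ∃ q ∈ M, q ∉ L :=
    ⟨Finset.not_subset.1 hc.1, Finset.not_subset.1 hc.2⟩
  have h1 := hcone.gap_nonneg (L ∩ Mᶜ) ⟨p, by simp [hpL, hpM]⟩
  have e1 : (L ∩ {s, t}).card = 1 := by
    rw [Finset.inter_insert_of_mem hL.left, Finset.inter_singleton_of_notMem hL.right]; simp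
  have e2 : (Mᶜ ∩ {s, t}).card = 1 := by
    rw [Finset.inter_insert_of_notMem (by simp [hM.left]),
      Finset.inter_singleton_of_mem (by simp [hM.right])]; simp
  have e3 : ((L ∪ Mᶜ) ∩ {s, t}).card = 2 := by
    rw [Finset.inter_insert_of_mem (by simp [hL.left]),
      Finset.inter_singleton_of_mem (by simp [hM.right]), Finset.card_pair hst]
  have h2 := hx.even_cut (L ∪ Mᶜ) ⟨s, by simp [hL.left]⟩
    (fun h => by have := Finset.mem_univ q; rw [← h] at this; simp [hqM, hqL] at this)
    (by rw [e3]; exact even_two)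
  rw [hx.gap_eq hst L, hx.gap_eq hst Mᶜ, hx.gap_eq hst (L ∪ Mᶜ), e1, e2, e3, cut_compl] at h
  have h3 := hL.lt
  have h4 := hM.lt
  push_cast at h
  linarith

/-- The level of a vertex is the number of chain members missing it, so the chain members are
sublevel sets at their ranks 0, 1, 2, and so on. No level is repeated before the sublevel set is
everything, so consecutive layers are nonempty. -/
theorem exists_level_function (𝓛 : Finset (Finset V))
    (hchain : ∀ L ∈ 𝓛, ∀ M ∈ 𝓛, L ⊆ M ∨ M ⊆ L) :
    ∃ ℓ : V → ℕ, (∀ L ∈ 𝓛, ∃ j, L = below ℓ j) ∧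
      (∀ j, below ℓ j = Finset.univ ∨ below ℓ j ∈ 𝓛) ∧
      ∀ j, below ℓ j ≠ Finset.univ → below ℓ j ≠ below ℓ (j + 1) := by
  set ℓ : V → ℕ := fun v => (𝓛.filter fun L => v ∉ L).card with hℓ
  set rk : Finset V → ℕ := fun L => (𝓛.filter fun M => M ⊂ L).card with hrk
  have hmem : ∀ L ∈ 𝓛, ∀ v, v ∈ L ↔ ℓ v ≤ rk L := by
    intro L hL v
    constructor
    · intro hv
      apply Finset.card_le_card
      intro M hM
      rw [Finset.mem_filter] at hM ⊢
      refine ⟨hM.1, ?_, fun h => hM.2 (h hv)⟩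
      exact (hchain L hL M hM.1).resolve_left fun h => hM.2 (h hv)
    · intro h
      by_contra hv
      refine absurd h (not_le.2 ?_)
      apply Finset.card_lt_card
      refine ⟨?_, ?_⟩
      · intro M hM
        rw [Finset.mem_filter] at hM ⊢
        exact ⟨hM.1, fun hvM => hv (hM.2.1 hvM)⟩
      · intro hsub
        have : L ∈ 𝓛.filter fun M => M ⊂ L := hsub (by simp [hL, hv])
        simp at this
  have hbelow : ∀ L ∈ 𝓛, L = below ℓ (rk L) := by
    intro L hL
    ext v
    rw [mem_below, hmem L hL]
  have hlt : ∀ L ∈ 𝓛, rk L < 𝓛.card := by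
    intro L hL
    apply Finset.card_lt_card
    refine ⟨Finset.filter_subset _ _, fun h => ?_⟩
    have := h hL
    simp at this
  have hinj : Set.InjOn rk 𝓛 := by
    intro L hL M hM h
    rw [hbelow L hL, hbelow M hM, h]
  have hsurj : ∀ j < 𝓛.card, ∃ L ∈ 𝓛, rk L = j := by
    intro j hj
    have h := Finset.surjOn_of_injOn_of_card_le (s := 𝓛) (t := Finset.range 𝓛.card) rk
      (fun L hL => by simpa using hlt L hL) hinj (by simp)
    obtain ⟨L, hL, h⟩ := h (show j ∈ (Finset.range 𝓛.card : Set ℕ) by simpa using hj)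
    exact ⟨L, hL, h⟩
  have hlarge : ∀ j, 𝓛.card ≤ j → below ℓ j = Finset.univ := by
    intro j hj
    ext v
    simp only [mem_below, Finset.mem_univ, iff_true]
    exact (Finset.card_le_card (Finset.filter_subset _ _)).trans hj
  refine ⟨ℓ, fun L hL => ⟨_, hbelow L hL⟩, ?_, ?_⟩
  · intro j
    rcases lt_or_ge j 𝓛.card with hj | hj
    · obtain ⟨L, hL, rfl⟩ := hsurj j hj
      exact Or.inr (by rwa [← hbelow L hL])
    · exact Or.inl (hlarge j hj)
  · intro j hj heq
    have h1 : j < 𝓛.card := by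
      by_contra! h; exact hj (hlarge j h)
    have h2 : j + 1 < 𝓛.card := by
      by_contra! h; exact hj (heq.trans (hlarge _ h))
    obtain ⟨L, hL, h3⟩ := hsurj j h1
    obtain ⟨M, hM, h4⟩ := hsurj (j + 1) h2
    have h5 : L = M := by rw [hbelow L hL, hbelow M hM, h3, h4, heq]
    subst h5
    omega

/-! ### The tree for the next peeling step. -/

/-- The tree to peel off when mass `σ` of `x` is left, all mass removed so far being carried by
trees that meet each cut of value less than `1 + σ` once. -/
theorem IsFeasible.exists_faceTree (hst : s ≠ t) (hx : IsFeasible s t x) {z : Edge V → ℝ} {σ : ℝ}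
    (hσ : 0 < σ) (hσ1 : σ ≤ 1) (hz : InCone z σ) (hu : InCone (x - z) (1 - σ))
    (htight : ∀ L, IsNarrow s t x (1 + σ) L →
      gap (x - z) (1 - σ) L = 0 ∧ gap (x - z) (1 - σ) Lᶜ = 0) :
    ∃ S, IsFaceTree z σ S ∧ ∀ L, IsNarrow s t x (1 + σ) L → (S ∩ cut L).card = 1 := by
  classical
  have : Nonempty V := ⟨s⟩
  have hgap : ∀ W, gap x 1 W = gap (x - z) (1 - σ) W + gap z σ W := by
    intro W
    rw [← gap_add]; simp
  have hle : ∀ F, weight z F ≤ weight x F := by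
    intro F
    have := weight_nonneg hu.nonneg F
    rw [weight_sub] at this
    linarith
  have hnar : ∀ L, IsNarrow s t x (1 + σ) L → IsNarrow s t x 2 L := fun L hL =>
    ⟨hL.left, hL.right, by linarith [hL.lt]⟩
  obtain ⟨ℓ, hℓ1, hℓ2, hℓ3⟩ := exists_level_function
    (Finset.univ.filter fun L => IsNarrow s t x (1 + σ) L) (by
      intro L hL M hM
      simp only [Finset.mem_filter, Finset.mem_univ, true_and] at hL hM
      exact (hnar L hL).total hst hx (hnar M hM))
  simp only [Finset.mem_filter, Finset.mem_univ, true_and] at hℓ1 hℓ2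
  -- The removed part has no slack here, so the slack of z is (x(C) - 1)/2 < σ/2.
  have hgapL : ∀ L, IsNarrow s t x (1 + σ) L → gap z σ L < σ ∧ gap z σ Lᶜ < σ := by
    intro L hL
    have h1 := htight L hL
    have h2 := hgap L
    have h3 := hgap Lᶜ
    have e1 : (L ∩ {s, t}).card = 1 := by
      rw [Finset.inter_insert_of_mem hL.left, Finset.inter_singleton_of_notMem hL.right]; simp
    have e2 : (Lᶜ ∩ {s, t}).card = 1 := by
      rw [Finset.inter_insert_of_notMem (by simp [hL.left]),
        Finset.inter_singleton_of_mem (by simp [hL.right])]; simp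
    rw [hx.gap_eq hst, e1] at h2
    rw [hx.gap_eq hst, e2, cut_compl] at h3
    have h4 := hL.lt
    push_cast at h2 h3
    constructor <;> linarith [h1.1, h1.2]
  -- The difference contains neither s nor t, and its cut has value below 2(1 + σ); half of that
  -- minus 1 is σ.
  have hgapW : ∀ L M, IsNarrow s t x (1 + σ) L → IsNarrow s t x (1 + σ) M →
      (M ∩ Lᶜ).Nonempty → gap z σ (M ∩ Lᶜ) < σ := by
    intro L M hL hM hne
    have h1 := (hu.tight_inter_union ⟨⟨s, hM.left⟩, (htight M hM).1⟩
      ⟨⟨t, by simp [hL.right]⟩, (htight L hL).2⟩ hne).1.2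
    have h2 := hgap (M ∩ Lᶜ)
    have e1 : (M ∩ Lᶜ ∩ {s, t}).card = 0 := by
      rw [Finset.inter_insert_of_notMem (by simp [hL.left]),
        Finset.inter_singleton_of_notMem (by simp [hM.right])]; simp
    have h3 : weight x (cut (M ∩ Lᶜ)) ≤ weight x (cut L) + weight x (cut M) := by
      unfold weight
      rw [← Finset.sum_union_inter]
      refine le_add_of_le_of_nonneg (weight_mono hx.nonneg ?_) (weight_nonneg hx.nonneg _)
      intro e he
      obtain ⟨u, v, huv, rfl⟩ := e.exists_eq
      simp only [mem_cut, Finset.mem_union, Finset.mem_inter, Finset.mem_compl] at he ⊢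
      tauto
    rw [hx.gap_eq hst, e1, h1] at h2
    have h4 := hL.lt
    have h5 := hM.lt
    push_cast at h2
    linarith
  have hempty : gap z σ ∅ < σ := by
    have : inside (∅ : Finset V) = ∅ := by
      ext e
      obtain ⟨u, v, huv, rfl⟩ := e.exists_eq
      simp [mem_inside]
    simp only [gap, this, weight, Finset.card_empty, Finset.sum_empty]
    push_cast
    linarith
  obtain ⟨S, hS, hS1⟩ := hz.exists_faceTree_layered (ℓ := ℓ) hσ
    (by
      intro j
      rcases hℓ2 j with h | h
      · rw [h, cut_univ]; simp [weight, hσ]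
      -- Tightness on both sides means that the removed part crosses the cut with weight exactly 1 -
      -- σ, leaving z less than 2σ.
      · have h1 := gap_split (x - z) (1 - σ) Finset.univ (below ℓ j)
        rw [Finset.univ_inter, inside_univ, Finset.univ_inter, ← Finset.compl_eq_univ_sdiff,
          (htight _ h).1, (htight _ h).2, hu.gap_univ, weight_sub] at h1
        linarith [h.lt])
    (by
      intro a b _
      rcases Nat.eq_zero_or_pos a with rfl | ha
      · have hb : slab ℓ 0 b = below ℓ b := by ext v; simp
        rw [hb]
        rcases hℓ2 b with h | h
        · rw [h, hz.gap_univ]; exact hσ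
        · exact (hgapL _ h).1
      · have hb : slab ℓ a b = below ℓ b ∩ (below ℓ (a - 1))ᶜ := by
          ext v
          simp only [mem_slab, Finset.mem_inter, mem_below, Finset.mem_compl]
          omega
        rw [hb]
        rcases hℓ2 (a - 1) with h | h
        · rw [h, Finset.compl_univ, Finset.inter_empty]; exact hempty
        · rcases hℓ2 b with h' | h'
          · rw [h', Finset.univ_inter]; exact (hgapL _ h).2
          · rcases (below ℓ b ∩ (below ℓ (a - 1))ᶜ).eq_empty_or_nonempty with h0 | h0
            · rw [h0]; exact hempty
            · exact hgapW _ _ h h' h0)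
    (by
      intro a
      have hcompl : (Finset.univ.filter fun v => a + 2 ≤ ℓ v) = (below ℓ (a + 1))ᶜ := by
        ext v
        simp only [Finset.mem_filter, Finset.mem_univ, true_and, Finset.mem_compl, mem_below]
        omega
      have hsub : below ℓ a ⊆ below ℓ (a + 1) := by
        intro v hv
        rw [mem_below] at hv ⊢
        omega
      rw [hcompl]
      rcases hℓ2 (a + 1) with h | h
      · have : btw (below ℓ a) (below ℓ (a + 1))ᶜ = ∅ := by
          rw [h]
          ext e
          obtain ⟨u, v, huv, rfl⟩ := e.exists_eq
          simp [mem_btw]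
        rw [this]; simpa [weight] using hσ
      · have hne : below ℓ a ≠ Finset.univ := by
          intro h'
          apply h.right
          apply hsub
          rw [h']
          exact Finset.mem_univ _
        have h' := (hℓ2 a).resolve_left hne
        -- Edges skipping the layer are counted twice when both cuts are added. The layer itself has
        -- an even cut of value at least 2, so twice the skipping weight is below 2(1 + σ) - 2.
        have h1 := weight_cut_diff_of_subset x hsub
        have hD : (below ℓ (a + 1) ∩ (below ℓ a)ᶜ).Nonempty := by
          rw [Finset.nonempty_iff_ne_empty]
          intro h0
          refine hℓ3 a hne (hsub.antisymm fun v hv => ?_)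
          by_contra hva
          have : v ∈ below ℓ (a + 1) ∩ (below ℓ a)ᶜ := by
            rw [Finset.mem_inter, Finset.mem_compl]; exact ⟨hv, hva⟩
          rw [h0] at this
          simp at this
        have e1 : ((below ℓ (a + 1) ∩ (below ℓ a)ᶜ) ∩ {s, t}).card = 0 := by
          rw [Finset.inter_insert_of_notMem
              (fun h0 => Finset.mem_compl.1 (Finset.mem_inter.1 h0).2 h'.left),
            Finset.inter_singleton_of_notMem (fun h0 => h.right (Finset.mem_inter.1 h0).1)]
          simp
        have h2 := hx.even_cut _ hD (fun h0 => by
          have := Finset.mem_univ t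
          rw [← h0] at this
          exact h.right (Finset.mem_inter.1 this).1) (by rw [e1]; exact Even.zero)
        have h3 := h.lt
        have h4 := h'.lt
        have h5 := hle (btw (below ℓ a) (below ℓ (a + 1))ᶜ)
        linarith)
  refine ⟨S, hS, fun L hL => ?_⟩
  obtain ⟨j, rfl⟩ := hℓ1 L hL
  refine le_antisymm (hS1 j) (Finset.card_pos.2 ?_)
  obtain ⟨e, he, heL⟩ := hS.tree.exists_mem_cut hL.left hL.right
  exact ⟨e, Finset.mem_inter.2 ⟨he, heL⟩⟩

/-! ### From single crossings to tightness, and the graph-theoretic form of trees. -/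

theorem IsTreeSet.isSpanningTree [Nonempty V] {S : Finset (Edge V)} (hS : IsTreeSet S) :
    IsSpanningTree S := by
  classical
  unfold IsSpanningTree
  set G := SimpleGraph.fromEdgeSet {e : Sym2 V | ∃ f ∈ S, f.1 = e} with hG
  rw [SimpleGraph.isTree_iff_connected_and_card]
  constructor
  · refine SimpleGraph.Connected.mk fun u v => ?_
    by_contra hv
    obtain ⟨e, he, hcut⟩ := hS.exists_mem_cut (X := Finset.univ.filter fun w => G.Reachable u w)
      (v := u) (w := v) (by simp) (by simpa using hv)
    obtain ⟨a, b, hab, rfl⟩ := e.exists_eq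
    have hne : a ≠ b := by simpa using hab
    have hadj : G.Adj a b := by
      rw [hG, SimpleGraph.fromEdgeSet_adj]
      exact ⟨⟨_, he, rfl⟩, hne⟩
    simp only [mem_cut, Finset.mem_filter, Finset.mem_univ, true_and] at hcut
    rcases hcut with ⟨h1, h2⟩ | ⟨h1, h2⟩
    · exact h2 (h1.trans hadj.reachable)
    · exact h2 (h1.trans hadj.symm.reachable)
  · have h : G.edgeSet = (S.image Subtype.val : Finset (Sym2 V)) := by
      ext e
      rw [hG, SimpleGraph.edgeSet_fromEdgeSet]
      simp only [Set.mem_sdiff, Set.mem_ofPred_eq, Finset.coe_image, Set.mem_image,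
        Finset.mem_coe]
      constructor
      · rintro ⟨h, -⟩; exact h
      · rintro ⟨f, hf, rfl⟩; exact ⟨⟨f, hf, rfl⟩, f.2⟩
    rw [h, Nat.card_coe_set_eq, Set.ncard_coe_finset,
      Finset.card_image_of_injective _ Subtype.val_injective, hS.card, Nat.card_eq_fintype_card]

theorem IsTreeSet.gap_eq_zero_of_card_cut {S : Finset (Edge V)} (hS : IsTreeSet S) {L : Finset V}
    (hne : L.Nonempty) (hne' : Lᶜ.Nonempty) (h : (S ∩ cut L).card = 1) :
    gap (chi S) 1 L = 0 ∧ gap (chi S) 1 Lᶜ = 0 := by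
  have h1 := gap_split (chi S) 1 Finset.univ L
  rw [Finset.univ_inter, inside_univ, Finset.univ_inter, ← Finset.compl_eq_univ_sdiff,
    hS.inCone.gap_univ, weight_chi, h] at h1
  have h2 := hS.inCone.gap_nonneg L hne
  have h3 := hS.inCone.gap_nonneg Lᶜ hne'
  push_cast at h1
  constructor <;> linarith

/-! ### The peeling process. -/

/-- The invariant of the peeling process: `z` is what is left of `x`, of total mass `σ`. -/
structure IsResidual (s t : V) (x z : Edge V → ℝ) (σ : ℝ) : Prop where
  pos : 0 < σ
  le_one : σ ≤ 1
  inCone : InCone z σ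
  removed : InCone (x - z) (1 - σ)
  tight : ∀ L, IsNarrow s t x (1 + σ) L →
    gap (x - z) (1 - σ) L = 0 ∧ gap (x - z) (1 - σ) Lᶜ = 0

open Classical in
/-- The number of strict inequalities that hold for a residual. -/
noncomputable def slackCount (s t : V) (x z : Edge V → ℝ) (σ : ℝ) : ℕ :=
  (Finset.univ.filter fun e => 0 < z e).card +
    (Finset.univ.filter fun A : Finset V => A.Nonempty ∧ 0 < gap z σ A).card +
    (Finset.univ.filter fun L => IsNarrow s t x (1 + σ) L).card

theorem gap_sub_smul (z : Edge V → ℝ) (σ ε : ℝ) (S : Finset (Edge V)) (A : Finset V) :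
    gap (z - ε • chi S) (σ - ε) A = gap z σ A - ε * gap (chi S) 1 A := by
  have h := gap_add (z - ε • chi S) (ε • chi S) (σ - ε) (ε * 1) A
  rw [gap_smul, mul_one, sub_add_cancel, sub_add_cancel] at h
  linarith

theorem sub_smul_chi_apply (z : Edge V → ℝ) (ε : ℝ) (S : Finset (Edge V)) (e : Edge V) :
    (z - ε • chi S) e = if e ∈ S then z e - ε else z e := by
  by_cases h : e ∈ S <;> simp [chi, h]

/-- The tree lies in the minimal face of z, so a positive multiple can be subtracted inside the
cone. Narrowness at the smaller mass implies narrowness before, so the invariant survives. -/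
theorem IsResidual.step (hst : s ≠ t) (hx : IsFeasible s t x) {z : Edge V → ℝ} {σ : ℝ}
    (hz : IsResidual s t x z σ) :
    ∃ (S : Finset (Edge V)) (ε : ℝ), IsTreeSet S ∧ 0 < ε ∧
      (∀ L, IsNarrow s t x (1 + σ) L → (S ∩ cut L).card = 1) ∧
      ((ε = σ ∧ z = σ • chi S) ∨
        (IsResidual s t x (z - ε • chi S) (σ - ε) ∧
          slackCount s t x (z - ε • chi S) (σ - ε) < slackCount s t x z σ)) := by
  classical
  have : Nonempty V := ⟨s⟩
  obtain ⟨S, hS, hS1⟩ := hx.exists_faceTree hst hz.pos hz.le_one hz.inCone hz.removed hz.tight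
  have hdef : ∀ A : Finset V, A.Nonempty → gap z σ A = 0 → gap (chi S) 1 A = 0 := fun A hA h =>
    hS.tree.gap_chi_eq_zero hA (hS.conn A ⟨hA, h⟩)
  -- All values of ε at which the mass runs out, an edge leaves the support, a set becomes tight, or
  -- a cut stops being narrow. The least of them is the step length, so unless the mass is
  -- exhausted, `slackCount` drops.
  set cand : Finset ℝ := insert σ (S.image z ∪
    ((Finset.univ.filter fun A : Finset V => A.Nonempty ∧ 0 < gap (chi S) 1 A).image
      fun A => gap z σ A / gap (chi S) 1 A) ∪
    ((Finset.univ.filter fun L => IsNarrow s t x (1 + σ) L).image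
      fun L => 1 + σ - weight x (cut L))) with hcand
  obtain ⟨ε, hε, hmin⟩ := Finset.exists_min_image cand id ⟨σ, by simp [hcand]⟩
  have hσε : ε ≤ σ := hmin σ (by simp [hcand])
  have heε : ∀ e ∈ S, ε ≤ z e := fun e he => hmin (z e) (by
    simp only [hcand, Finset.mem_insert, Finset.mem_union, Finset.mem_image]
    exact Or.inr (Or.inl (Or.inl ⟨e, he, rfl⟩)))
  have hAε : ∀ A : Finset V, A.Nonempty → 0 < gap (chi S) 1 A →
      ε ≤ gap z σ A / gap (chi S) 1 A := fun A hA h => hmin _ (by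
    simp only [hcand, Finset.mem_insert, Finset.mem_union, Finset.mem_image, Finset.mem_filter,
      Finset.mem_univ, true_and]
    exact Or.inr (Or.inl (Or.inr ⟨A, ⟨hA, h⟩, rfl⟩)))
  have hgappos : ∀ A : Finset V, A.Nonempty → 0 < gap (chi S) 1 A → 0 < gap z σ A := by
    intro A hA h
    refine lt_of_le_of_ne (hz.inCone.gap_nonneg A hA) fun h0 => ?_
    exact h.ne' (hdef A hA h0.symm)
  have hεcases : ε = σ ∨ (∃ e ∈ S, z e = ε) ∨
      (∃ A : Finset V, (A.Nonempty ∧ 0 < gap (chi S) 1 A) ∧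
        gap z σ A / gap (chi S) 1 A = ε) ∨
      ∃ L, IsNarrow s t x (1 + σ) L ∧ 1 + σ - weight x (cut L) = ε := by
    simpa only [hcand, Finset.mem_insert, Finset.mem_union, Finset.mem_image, Finset.mem_filter,
      Finset.mem_univ, true_and, or_assoc] using hε
  have hε0 : 0 < ε := by
    rcases hεcases with h | ⟨e, he, h⟩ | ⟨A, ⟨hA, hA'⟩, h⟩ | ⟨L, hL, h⟩
    · rw [h]; exact hz.pos
    · rw [← h]; exact hS.pos e he
    · rw [← h]; exact div_pos (hgappos A hA hA') hA'
    · rw [← h]; linarith [hL.lt]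
  have hcone : InCone (z - ε • chi S) (σ - ε) := by
    refine ⟨fun e => ?_, fun A hA => ?_, ?_⟩
    · rw [sub_smul_chi_apply]
      split_ifs with h
      · exact sub_nonneg.2 (heε e h)
      · exact hz.inCone.nonneg e
    · rw [gap_sub_smul, sub_nonneg]
      rcases (hS.tree.inCone.gap_nonneg A hA).eq_or_lt with h | h
      · rw [← h, mul_zero]; exact hz.inCone.gap_nonneg A hA
      · exact (le_div_iff₀ h).1 (hAε A hA h)
    · rw [gap_sub_smul, hz.inCone.gap_univ, hS.tree.inCone.gap_univ]; simp
  refine ⟨S, ε, hS.tree, hε0, hS1, ?_⟩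
  rcases hσε.eq_or_lt with hσ | hσ
  · refine Or.inl ⟨hσ, ?_⟩
    subst hσ
    have h0 := hcone.gap_univ
    rw [sub_self] at h0
    unfold gap at h0
    rw [zero_mul, zero_sub, neg_eq_zero, inside_univ] at h0
    funext e
    have h1 := (Finset.sum_eq_zero_iff_of_nonneg (fun e _ => hcone.nonneg e)).1 h0 e
      (Finset.mem_univ e)
    exact sub_eq_zero.1 h1
  · right
    have hrem : x - (z - ε • chi S) = (x - z) + ε • chi S := by abel
    have hmass : 1 - (σ - ε) = (1 - σ) + ε * 1 := by ring
    have hmono : ∀ L, IsNarrow s t x (1 + (σ - ε)) L → IsNarrow s t x (1 + σ) L := fun L hL =>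
      ⟨hL.left, hL.right, by linarith [hL.lt]⟩
    have hsub1 : (Finset.univ.filter fun e => 0 < (z - ε • chi S) e) ⊆
        Finset.univ.filter fun e => 0 < z e := by
      intro e he
      rw [Finset.mem_filter] at he ⊢
      refine ⟨he.1, ?_⟩
      have h := he.2
      rw [sub_smul_chi_apply] at h
      split_ifs at h
      · linarith
      · exact h
    have hsub2 : (Finset.univ.filter fun A : Finset V =>
          A.Nonempty ∧ 0 < gap (z - ε • chi S) (σ - ε) A) ⊆
        Finset.univ.filter fun A : Finset V => A.Nonempty ∧ 0 < gap z σ A := by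
      intro A hA
      rw [Finset.mem_filter] at hA ⊢
      refine ⟨hA.1, hA.2.1, ?_⟩
      have h := hA.2.2
      rw [gap_sub_smul] at h
      have := mul_nonneg hε0.le (hS.tree.inCone.gap_nonneg A hA.2.1)
      linarith
    have hsub3 : (Finset.univ.filter fun L => IsNarrow s t x (1 + (σ - ε)) L) ⊆
        Finset.univ.filter fun L => IsNarrow s t x (1 + σ) L := by
      intro L hL
      rw [Finset.mem_filter] at hL ⊢
      exact ⟨hL.1, hmono L hL.2⟩
    refine ⟨⟨by linarith, by linarith [hz.le_one], hcone, ?_, ?_⟩, ?_⟩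
    · rw [hrem, hmass]
      exact hz.removed.add (hS.tree.inCone.smul hε0.le)
    · intro L hL
      have h1 := hz.tight L (hmono L hL)
      have h2 := hS.tree.gap_eq_zero_of_card_cut ⟨s, hL.left⟩
        ⟨t, Finset.mem_compl.2 hL.right⟩ (hS1 L (hmono L hL))
      rw [hrem, hmass, gap_add, gap_add, gap_smul, gap_smul, h1.1, h1.2, h2.1, h2.2]
      simp
    · have c1 := Finset.card_le_card hsub1
      have c2 := Finset.card_le_card hsub2
      have c3 := Finset.card_le_card hsub3
      unfold slackCount
      rcases hεcases with h | ⟨e, he, h⟩ | ⟨A, ⟨hA, hA'⟩, h⟩ | ⟨L, hL, h⟩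
      · exact absurd h hσ.ne
      · have := Finset.card_lt_card ((Finset.ssubset_iff_of_subset hsub1).2 ⟨e, by
          simpa using hS.pos e he, by
          rw [Finset.mem_filter, sub_smul_chi_apply, if_pos he, h]; simp⟩)
        omega
      · have := Finset.card_lt_card ((Finset.ssubset_iff_of_subset hsub2).2 ⟨A, by
          simpa using ⟨hA, hgappos A hA hA'⟩, by
          rw [Finset.mem_filter, gap_sub_smul, ← h, div_mul_cancel₀ _ hA'.ne']; simp⟩)
        omega
      · have := Finset.card_lt_card ((Finset.ssubset_iff_of_subset hsub3).2 ⟨L, by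
          simpa using hL, by
          rw [Finset.mem_filter]
          intro h'
          linarith [h'.2.lt]⟩)
        omega

/-- In the last clause, σ minus the sum over earlier indices is the mass left when tree j is chosen;
the threshold is the one valid at that moment. -/
theorem IsResidual.exists_decomposition (hst : s ≠ t) (hx : IsFeasible s t x) :
    ∀ (k : ℕ) (z : Edge V → ℝ) (σ : ℝ), IsResidual s t x z σ → slackCount s t x z σ = k →
      ∃ (r : ℕ) (S : Fin r → Finset (Edge V)) (p : Fin r → ℝ),
        (∀ j, IsTreeSet (S j)) ∧ (∀ j, 0 < p j) ∧ ∑ j, p j = σ ∧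
        z = ∑ j, p j • chi (S j) ∧
        ∀ j L, IsNarrow s t x (1 + (σ - ∑ i, if i < j then p i else 0)) L →
          (S j ∩ cut L).card = 1 := by
  intro k
  induction k using Nat.strong_induction_on with
  | _ k ih =>
    intro z σ hz hk
    obtain ⟨T, ε, hT, hε, hT1, ⟨rfl, hzT⟩ | ⟨hres, hlt⟩⟩ := hz.step hst hx
    · refine ⟨1, fun _ => T, fun _ => ε, fun _ => hT, fun _ => hε, by simp, by simpa using hzT, ?_⟩
      intro j L hL
      apply hT1
      have hj : (∑ i : Fin 1, if i < j then ε else 0) = 0 :=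
        Finset.sum_eq_zero fun i _ => by rw [if_neg]; omega
      rwa [hj, sub_zero] at hL
    · obtain ⟨r, S, p, hS, hp, hsum, hdec, hcut⟩ := ih _ (hk ▸ hlt) _ _ hres rfl
      refine ⟨r + 1, Fin.cons T S, Fin.cons ε p, ?_, ?_, ?_, ?_, ?_⟩
      · intro j
        refine Fin.cases ?_ (fun i => ?_) j
        · simpa using hT
        · simpa using hS i
      · intro j
        refine Fin.cases ?_ (fun i => ?_) j
        · simpa using hε
        · simpa using hp i
      · rw [Fin.sum_univ_succ]
        simp [hsum]
      · rw [Fin.sum_univ_succ]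
        simp only [Fin.cons_zero, Fin.cons_succ, ← hdec]
        abel
      · intro j
        refine Fin.cases ?_ (fun i => ?_) j
        · intro L hL
          simp only [Fin.not_lt_zero, if_false, Finset.sum_const_zero, sub_zero] at hL
          simpa using hT1 L hL
        · intro L hL
          rw [Fin.sum_univ_succ] at hL
          simp only [Fin.cons_zero, Fin.cons_succ, Fin.succ_pos, if_true,
            Fin.succ_lt_succ_iff] at hL
          simp only [Fin.cons_succ]
          apply hcut i L
          rwa [← sub_sub] at hL

/-- The even cut constraints force a narrow cut to separate s from t; complementing if necessary
puts s inside. -/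
theorem IsFeasible.exists_eq_cut_of_mem_narrowCuts (hst : s ≠ t) (hx : IsFeasible s t x)
    {C : Finset (Edge V)}
    (hC : C ∈ narrowCuts x) : ∃ L, IsNarrow s t x 2 L ∧ C = cut L ∧ 1 ≤ weight x (cut L) := by
  obtain ⟨⟨U, hU, hU', rfl⟩, hlt⟩ := hC
  have hodd : Odd (U ∩ {s, t}).card := by
    rw [← Nat.not_even_iff_odd]
    intro h
    exact absurd (hx.even_cut U hU hU' h) (not_le.2 hlt)
  have h1 := hx.odd_cut U hU hU' hodd
  by_cases hs : s ∈ U <;> by_cases ht : t ∈ U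
  · exfalso
    rw [Finset.inter_eq_right.2 (by simp [Finset.insert_subset_iff, hs, ht])] at hodd
    rw [Finset.card_pair hst] at hodd
    exact absurd hodd (by decide)
  · exact ⟨U, ⟨hs, ht, hlt⟩, rfl, h1⟩
  · exact ⟨Uᶜ, ⟨by simpa using hs, by simpa using ht, by rwa [cut_compl]⟩,
      (cut_compl U).symm, by rwa [cut_compl]⟩
  · exfalso
    rw [Finset.inter_insert_of_notMem hs, Finset.inter_singleton_of_notMem ht] at hodd
    simp at hodd

end PathTSP

/-! ### The decomposition theorem. -/

theorem theorem3 {V : Type*} [Fintype V] [DecidableEq V] (s t : V) (hst : s ≠ t)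
    (x : PathTSP.Edge V → ℝ) (hx : PathTSP.IsFeasible s t x) :
    (∃ (r : ℕ) (S : Fin r → Finset (PathTSP.Edge V)) (p : Fin r → ℝ),
      (∀ j, PathTSP.IsSpanningTree (S j)) ∧
      (∀ j, 0 < p j) ∧
      ∑ j, p j = 1 ∧
      x = ∑ j, p j • PathTSP.chi (S j) ∧
      ∀ C ∈ PathTSP.narrowCuts x, ∃ k : Fin r,
        2 - PathTSP.weight x C ≤ ∑ j ∈ Finset.Iic k, p j ∧
        ∀ j ≤ k, (C ∩ S j).card = 1) ∧
    (∃ S : Finset (PathTSP.Edge V),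
      PathTSP.IsGlobalGaoTree x S ∧ ∀ e ∈ S, 0 < x e) := by
  classical
  have : Nonempty V := ⟨s⟩
  have hres : PathTSP.IsResidual s t x x 1 := by
    refine ⟨one_pos, le_rfl, hx.inCone hst, ?_, ?_⟩
    · rw [sub_self, sub_self]
      refine ⟨fun e => le_rfl, fun A _ => ?_, ?_⟩ <;> simp [PathTSP.gap, PathTSP.weight]
    · intro L _
      simp [PathTSP.gap, PathTSP.weight]
  obtain ⟨r, S, p, hS, hp, hsum, hdec, hcut⟩ := hres.exists_decomposition hst hx _ _ _ rfl
  have hr : 0 < r := by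
    rcases Nat.eq_zero_or_pos r with rfl | h
    · simp at hsum
    · exact h
  have hprefix : ∀ j : Fin r, (∑ i, if i < j then p i else 0) = ∑ i ∈ Finset.Iio j, p i := by
    intro j
    rw [← Finset.sum_filter]
    congr 1
    ext i; simp
  refine ⟨⟨r, S, p, fun j => (hS j).isSpanningTree, hp, hsum, hdec, ?_⟩, S ⟨0, hr⟩, ?_, ?_⟩
  · intro C hC
    obtain ⟨L, hL, rfl, hL1⟩ := hx.exists_eq_cut_of_mem_narrowCuts hst hC
    -- The last tree chosen while the mass already removed is below 2 - x(C). Index 0 qualifies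
    -- because C is narrow.
    obtain ⟨k, hk, hmax⟩ := Finset.exists_max_image
      (Finset.univ.filter fun k : Fin r =>
        ∑ i ∈ Finset.Iio k, p i < 2 - PathTSP.weight x (PathTSP.cut L))
      id ⟨⟨0, hr⟩, by
        have h0 : (Finset.Iio (⟨0, hr⟩ : Fin r)) = ∅ := by
          ext i; simp [Fin.lt_def]
        simp only [Finset.mem_filter, Finset.mem_univ, true_and, h0, Finset.sum_empty]
        linarith [hL.lt]⟩
    simp only [Finset.mem_filter, Finset.mem_univ, true_and, id] at hk hmax
    refine ⟨k, ?_, ?_⟩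
    · by_contra! hlt
      by_cases hkr : k.1 + 1 < r
      · have heq : Finset.Iio (⟨k.1 + 1, hkr⟩ : Fin r) = Finset.Iic k := by
          ext i
          simp only [Finset.mem_Iio, Finset.mem_Iic, Fin.lt_def, Fin.le_def]
          omega
        have h := hmax ⟨k.1 + 1, hkr⟩ (by rw [heq]; exact hlt)
        rw [Fin.le_def] at h
        simp at h
      -- If k is the last index, the prefix sum is 1, and 2 - x(C) ≤ 1 because a cut separating s
      -- from t has value at least 1.
      · have heq : Finset.Iic k = Finset.univ := by
          ext i
          simp only [Finset.mem_Iic, Finset.mem_univ, iff_true, Fin.le_def]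
          omega
        rw [heq, hsum] at hlt
        linarith
    · intro j hj
      rw [Finset.inter_comm]
      apply hcut j L
      refine ⟨hL.left, hL.right, ?_⟩
      rw [hprefix]
      have : ∑ i ∈ Finset.Iio j, p i ≤ ∑ i ∈ Finset.Iio k, p i :=
        Finset.sum_le_sum_of_subset_of_nonneg (Finset.Iio_subset_Iio hj) fun i _ _ => (hp i).le
      linarith
  · refine ⟨(hS _).isSpanningTree, fun C hC => ⟨(hS _).isSpanningTree, ?_⟩⟩
    obtain ⟨L, hL, rfl, -⟩ := hx.exists_eq_cut_of_mem_narrowCuts hst hC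
    rw [Finset.inter_comm]
    apply hcut _ L
    refine ⟨hL.left, hL.right, ?_⟩
    have h0 : (∑ i, if i < (⟨0, hr⟩ : Fin r) then p i else 0) = 0 :=
      Finset.sum_eq_zero fun i _ => by rw [if_neg]; simp [Fin.lt_def]
    rw [h0]
    linarith [hL.lt]
  · intro e he
    rw [hdec, Finset.sum_apply]
    refine Finset.sum_pos' (fun j _ => ?_) ⟨⟨0, hr⟩, Finset.mem_univ _, ?_⟩
    · simp only [Pi.smul_apply, smul_eq_mul]
      exact mul_nonneg (hp j).le ((hS j).inCone.nonneg e)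
    · simpa [PathTSP.chi, he] using hp ⟨0, hr⟩
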